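/- **Setting.** Let $(M,\Omega,\mathbb T,\mu)$ be a compact connected toric symplectic manifold of dimension $2n$: the torus $\mathbb T=\mathbb T^n$ with Lie algebra $\mathfrak t$ acts smoothly and effectively on $(M,\Omega)$ by symplectomorphisms, with $\mathbb T$-invariant moment map $\mu:M\to\mathfrak t^*$, $\iota_{X_\varsigma}\Omega=-d\mu_\varsigma$ for $\varsigma\in\mathfrak t$, where $X_\varsigma$ is the fundamental vector field of $\varsigma$ and $\mu_\varsigma=\langle\mu,\varsigma\rangle$. Put $\Delta=\mu(M)$ and $\mathring M=\mu^{-1}(\mathring\Delta)$, where $\mathring\Delta$ is the interior of $\Delta$ in $\mathfrak t^*$, and let $\mathcal D_x=\mathrm{span}\{X_\varsigma(x):\varsigma\in\mathfrak t\}\subset T_xM$. Let $(\mathbb J_1,\mathbb J_2)$ be a $\mathbb T$-invariant generalized Kähler structure of symplectic type on $M$, written in a $\mathbb T$-invariant splitting. That is, $\mathbb J_1,\mathbb J_2$ are commuting $\mathbb T$-invariant generalized complex structures on $TM\oplus T^*M$ (orthogonal for the pairing $(X+\xi,Y+\eta)=\xi(Y)+\eta(X)$, and integrable for the Courant bracket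 twisted by a closed 3-form $H$), $\mathcal G=-\mathbb J_1\mathbb J_2$ is a generalized metric, and for some 2-form $b$ $$\mathbb J_2=e^{-b}\,\mathbb J_\Omega\, e^{b},\qquad \mathbb J_\Omega(X+\xi)=\Omega^{-1}\xi-\Omega X,\qquad e^{b}(X+\xi)=X+\xi+\iota_Xb .$$ The complex structures $J_\pm$ of its biHermitian description are given by $J_\pm X=-\pi\,\mathbb J_1 e$, where $\pi:TM\oplus T^*M\to TM$ is the projection and $e$ is the unique element with $\mathcal Ge=\pm e$ and $\pi e=X$. Let $\beta_1=\pi\circ\mathbb J_1|_{T^*M}$ be the Poisson structure associated to $\mathbb J_1$. The extended $\mathbb T$-action is $\varphi(\varsigma)=X_\varsigma-\iota_{X_\varsigma}b$. It is called *Hamiltonian* with moment map $\mu$ if $\mu$ is equivariant and $\mathbb J_2(\varphi(\varsigma)-\sqrt{-1}\,d\mu_\varsigma)=\sqrt{-1}\,(\varphi(\varsigma)-\sqrt{-1}\,d\mu_\varsigma)$ for all $\varsigma\in\mathfrak t$, and *strong Hamiltonian* if moreover $\beta_1(d\mu_\varsigma,d\mu_\zeta)=0$ on $M$ for all $\varsigma,\zeta\in\mathfrak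 t$. **Theorem 4.3.** The structure is anti-diagonal, i.e. $J_+\mathcal D=J_-\mathcal D$, if and only if the extended $\mathbb T$-action is strong Hamiltonian. This holds both when the equality $J_+\mathcal D_x=J_-\mathcal D_x$ is required only for $x\in\mathring M$ (where $\mathcal D$ is a Lagrangian distribution) and when it is required for all $x\in M$. -/

import Mathlib

open scoped Manifold ContDiff

set_option linter.unusedSectionVars false

/-! ### Linear algebra of `V ⊕ V*` -/

section LinearAlgebra

variable {V : Type*} [AddCommGroup V] [Module ℝ V] [TopologicalSpace V]
  [IsTopologicalAddGroup V] [ContinuousSMul ℝ V]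

/-- The natural pairing `(X + ξ, Y + η) = ξ(Y) + η(X)` on `V ⊕ V*`. -/
def genPairing (u v : V × (V →L[ℝ] ℝ)) : ℝ := u.2 v.1 + v.2 u.1

/-- The contraction `ι_X σ = σ(X, ·)` of a 2-form, as a linear map `V → V*`. -/
def contract₂ (σ : V [⋀^Fin 2]→L[ℝ] ℝ) : V →ₗ[ℝ] (V →L[ℝ] ℝ) where
  toFun X := σ.toContinuousMultilinearMap.toContinuousLinearMap ![X, 0] 1
  map_add' X Y := by
    ext Z
    have h : ∀ W : V, Function.update ![W, 0] 1 Z = ![W, Z] := by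
      intro W; ext i; fin_cases i <;> simp
    have := σ.toAlternatingMap.map_vecCons_add ![Z] X Y
    simpa [h] using this
  map_smul' c X := by
    ext Z
    have h : ∀ W : V, Function.update ![W, 0] 1 Z = ![W, Z] := by
      intro W; ext i; fin_cases i <;> simp
    have := σ.toAlternatingMap.map_vecCons_smul ![Z] c X
    simpa [h] using this

theorem contract₂_apply (σ : V [⋀^Fin 2]→L[ℝ] ℝ) (X Y : V) :
    contract₂ σ X Y = σ ![X, Y] := by
  have h : Function.update ![X, 0] 1 Y = ![X, Y] := by
    ext i; fin_cases i <;> simp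
  simp [contract₂, h]

/-- The double contraction `ι_Y ι_X σ = σ(X, Y, ·)` of a 3-form. -/
def contract₃ (σ : V [⋀^Fin 3]→L[ℝ] ℝ) (X Y : V) : V →L[ℝ] ℝ :=
  σ.toContinuousMultilinearMap.toContinuousLinearMap ![X, Y, 0] 2

theorem contract₃_apply (σ : V [⋀^Fin 3]→L[ℝ] ℝ) (X Y Z : V) :
    contract₃ σ X Y Z = σ ![X, Y, Z] := by
  have h : Function.update ![X, Y, 0] 2 Z = ![X, Y, Z] := by
    ext i; fin_cases i <;> simp
  simp [contract₃, h]

/-- The B-transform `e^b (X + ξ) = X + ξ + ι_X b`. -/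
def bTransform (b : V [⋀^Fin 2]→L[ℝ] ℝ) :
    (V × (V →L[ℝ] ℝ)) →ₗ[ℝ] (V × (V →L[ℝ] ℝ)) :=
  LinearMap.prod (LinearMap.fst ℝ V (V →L[ℝ] ℝ))
    (LinearMap.snd ℝ V (V →L[ℝ] ℝ) + contract₂ b ∘ₗ LinearMap.fst ℝ V (V →L[ℝ] ℝ))

variable [T2Space V] [FiniteDimensional ℝ V]

theorem finrank_dual_eq : Module.finrank ℝ V = Module.finrank ℝ (V →L[ℝ] ℝ) := by
  rw [← (LinearMap.toContinuousLinearMap (𝕜 := ℝ) (E := V) (F' := ℝ)).finrank_eq]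
  exact (Subspace.dual_finrank_eq (K := ℝ) (V := V)).symm

/-- The isomorphism `X ↦ ι_X σ` from `V` to `V*` given by a nondegenerate 2-form. -/
noncomputable def flatEquiv (σ : V [⋀^Fin 2]→L[ℝ] ℝ)
    (hσ : ∀ X : V, (∀ Y, σ ![X, Y] = 0) → X = 0) : V ≃ₗ[ℝ] (V →L[ℝ] ℝ) :=
  haveI : FiniteDimensional ℝ (V →L[ℝ] ℝ) :=
    LinearEquiv.finiteDimensional (LinearMap.toContinuousLinearMap (𝕜 := ℝ) (E := V) (F' := ℝ))
  LinearMap.linearEquivOfInjective (contract₂ σ)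
    (LinearMap.ker_eq_bot.mp (LinearMap.ker_eq_bot'.mpr fun X hX => hσ X fun Y => by
      rw [← contract₂_apply, hX]; rfl))
    finrank_dual_eq

/-- The endomorphism `X + ξ ↦ σ⁻¹ ξ - σ X` of `V ⊕ V*`. -/
noncomputable def symplecticEndo (σ : V [⋀^Fin 2]→L[ℝ] ℝ)
    (hσ : ∀ X : V, (∀ Y, σ ![X, Y] = 0) → X = 0) :
    (V × (V →L[ℝ] ℝ)) →ₗ[ℝ] (V × (V →L[ℝ] ℝ)) :=
  LinearMap.prod
    ((flatEquiv σ hσ).symm.toLinearMap ∘ₗ LinearMap.snd ℝ V (V →L[ℝ] ℝ))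
    (-((flatEquiv σ hσ).toLinearMap ∘ₗ LinearMap.fst ℝ V (V →L[ℝ] ℝ)))

/-- A generalized metric on `V ⊕ V*`: an orthogonal and self-adjoint operator `G` for which
`(G ·, ·)` is positive definite. -/
structure IsGenMetric (G : (V × (V →L[ℝ] ℝ)) →ₗ[ℝ] (V × (V →L[ℝ] ℝ))) : Prop where
  orthogonal : ∀ u v, genPairing (G u) (G v) = genPairing u v
  selfAdjoint : ∀ u v, genPairing (G u) v = genPairing u (G v)
  posDef : ∀ u, u ≠ 0 → 0 < genPairing (G u) u

namespace IsGenMetric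

variable {G : (V × (V →L[ℝ] ℝ)) →ₗ[ℝ] (V × (V →L[ℝ] ℝ))}

theorem sq (hG : IsGenMetric G) (u : V × (V →L[ℝ] ℝ)) : G (G u) = u := by
  have key : ∀ v, genPairing (G (G u) - u) v = 0 := by
    intro v
    have h := (hG.selfAdjoint (G u) v).trans (hG.orthogonal u v)
    simp only [genPairing, Prod.fst_sub, Prod.snd_sub, map_sub,
      sub_apply] at h ⊢
    linarith
  by_contra hne
  have h1 := hG.posDef _ (sub_ne_zero.mpr hne)
  rw [hG.selfAdjoint, key] at h1
  exact lt_irrefl _ h1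

/-- The projections of the eigenspaces `C_± = ker (G ∓ 1)` to `V` are bijective. -/
theorem proj_bijective (hG : IsGenMetric G) (ε : ℝ) (hε : ε * ε = 1) :
    Function.Bijective (LinearMap.fst ℝ V (V →L[ℝ] ℝ) ∘ₗ
      (LinearMap.ker (G - ε • LinearMap.id)).subtype) := by
  have mem : ∀ (δ : ℝ) u, u ∈ LinearMap.ker (G - δ • LinearMap.id) ↔ G u = δ • u := by
    intro δ u
    simp [LinearMap.mem_ker, sub_eq_zero]
  -- an eigenvector that lies in `V*` vanishes
  have inj : ∀ (δ : ℝ) u, G u = δ • u → u.1 = 0 → u = 0 := by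
    intro δ u hu h0
    by_contra hne
    have h1 := hG.posDef u hne
    rw [hu] at h1
    simp [genPairing, h0] at h1
  have injl : ∀ δ : ℝ, Function.Injective (LinearMap.fst ℝ V (V →L[ℝ] ℝ) ∘ₗ
      (LinearMap.ker (G - δ • LinearMap.id)).subtype) := by
    intro δ
    refine (injective_iff_map_eq_zero _).mpr ?_
    rintro ⟨u, hu⟩ h
    exact Subtype.ext (inj δ u ((mem δ u).mp hu) h)
  have : FiniteDimensional ℝ (V →L[ℝ] ℝ) :=
    LinearEquiv.finiteDimensional (LinearMap.toContinuousLinearMap (𝕜 := ℝ) (E := V) (F' := ℝ))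
  refine ⟨injl ε, ?_⟩
  have d1 := LinearMap.finrank_le_finrank_of_injective (injl (-ε))
  have d2 := LinearMap.finrank_le_finrank_of_injective (injl ε)
  have htop : LinearMap.ker (G - ε • LinearMap.id) ⊔ LinearMap.ker (G - (-ε) • LinearMap.id)
      = ⊤ := by
    rw [eq_top_iff]
    intro u _
    have hu : u = (1 / 2 : ℝ) • (u + ε • G u) + (1 / 2 : ℝ) • (u - ε • G u) := by
      module
    rw [hu]
    refine Submodule.add_mem_sup (Submodule.smul_mem _ _ ?_) (Submodule.smul_mem _ _ ?_)
    · rw [mem, map_add, map_smul, hG.sq, smul_add, smul_smul, hε, one_smul, add_comm]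
    · rw [mem, map_sub, map_smul, hG.sq, smul_sub, smul_smul, neg_mul, hε]
      module
  have d3 := Submodule.finrank_add_le_finrank_add_finrank
    (LinearMap.ker (G - ε • LinearMap.id)) (LinearMap.ker (G - (-ε) • LinearMap.id))
  rw [htop, finrank_top, Module.finrank_prod, ← finrank_dual_eq (V := V)] at d3
  have d4 : Module.finrank ℝ (LinearMap.ker (G - ε • LinearMap.id)) = Module.finrank ℝ V := by
    omega
  exact (LinearMap.injective_iff_surjective_of_finrank_eq_finrank
    (V := LinearMap.ker (G - ε • LinearMap.id)) (V₂ := V) (K := ℝ) d4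
    (f := LinearMap.fst ℝ V (V →L[ℝ] ℝ) ∘ₗ
      (LinearMap.ker (G - ε • LinearMap.id)).subtype)).mp (injl ε)

/-- The inverse `V → C_±` of the projection, where `C_± = ker (G ∓ 1)`; the sign is `ε`. -/
noncomputable def lift (hG : IsGenMetric G) (ε : ℝ) (hε : ε * ε = 1) :
    V →ₗ[ℝ] (V × (V →L[ℝ] ℝ)) :=
  (LinearMap.ker (G - ε • LinearMap.id)).subtype ∘ₗ
    (LinearEquiv.ofBijective _ (hG.proj_bijective ε hε)).symm.toLinearMap

end IsGenMetric

end LinearAlgebra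

/-! ### Forms, sections and the Courant bracket on a manifold -/

section Manifold

open VectorField

variable (m : ℕ) (M : Type*) [TopologicalSpace M] [ChartedSpace (EuclideanSpace ℝ (Fin m)) M]

/-- Vector fields on `M`, without regularity. -/
abbrev VField := ∀ x : M, TangentSpace (𝓡 m) x

/-- Differential `k`-forms on `M`, without regularity. -/
abbrev DForm (k : ℕ) := ∀ x : M, (TangentSpace (𝓡 m) x) [⋀^Fin k]→L[ℝ] ℝ

/-- Covector fields on `M`, without regularity. -/
abbrev CovField := ∀ x : M, TangentSpace (𝓡 m) x →L[ℝ] ℝ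

variable {M} in
/-- The fibre of `TM ⊕ T*M` at `x`. -/
abbrev GenTangent (x : M) := TangentSpace (𝓡 m) x × (TangentSpace (𝓡 m) x →L[ℝ] ℝ)

/-- Sections of `TM ⊕ T*M`, without regularity. -/
abbrev GenField := ∀ x : M, GenTangent m x

/-- Fibrewise linear endomorphisms of `TM ⊕ T*M`, without regularity. -/
abbrev GenEndo := ∀ x : M, GenTangent m x →ₗ[ℝ] GenTangent m x

variable {m M} [IsManifold (𝓡 m) ∞ M]

/-- Smooth vector fields. -/
def IsSmoothVField (X : VField m M) : Prop :=
  ContMDiff (𝓡 m) (𝓡 m).tangent ∞ fun x => (⟨x, X x⟩ : TangentBundle (𝓡 m) M)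

/-- A form is smooth if its value on smooth vector fields is smooth. -/
def IsSmoothForm {k : ℕ} (σ : DForm m M k) : Prop :=
  ∀ X : Fin k → VField m M, (∀ i, IsSmoothVField (X i)) →
    ContMDiff (𝓡 m) 𝓘(ℝ, ℝ) ∞ fun x => σ x fun i => X i x

/-- Smooth sections of `TM ⊕ T*M`. -/
def IsSmoothGenField (s : GenField m M) : Prop :=
  IsSmoothVField (fun x => (s x).1) ∧
    ∀ Y : VField m M, IsSmoothVField Y →
      ContMDiff (𝓡 m) 𝓘(ℝ, ℝ) ∞ fun x => (s x).2 (Y x)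

/-- A form in the chart centred at `x₀`, that is, pulled back by the inverse of this chart. -/
noncomputable def DForm.inChart {k : ℕ} (σ : DForm m M k) (x₀ : M) :
    EuclideanSpace ℝ (Fin m) → (EuclideanSpace ℝ (Fin m)) [⋀^Fin k]→L[ℝ] ℝ := fun y =>
  (σ ((extChartAt (𝓡 m) x₀).symm y)).compContinuousLinearMap
    (mfderiv 𝓘(ℝ, EuclideanSpace ℝ (Fin m)) (𝓡 m) (extChartAt (𝓡 m) x₀).symm y)

/-- The exterior derivative: at `x`, it is computed in the chart centred at `x` and pulled
back. -/
noncomputable def DForm.d {k : ℕ} (σ : DForm m M k) : DForm m M (k + 1) := fun x =>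
  (extDeriv (σ.inChart x) (extChartAt (𝓡 m) x x)).compContinuousLinearMap
    (mfderiv (𝓡 m) 𝓘(ℝ, EuclideanSpace ℝ (Fin m)) (extChartAt (𝓡 m) x) x)

/-- A covector field as a 1-form. -/
noncomputable def CovField.toForm (ξ : CovField m M) : DForm m M 1 := fun x =>
  ContinuousAlternatingMap.ofSubsingleton ℝ (TangentSpace (𝓡 m) x) ℝ (0 : Fin 1) (ξ x)

/-- The `H`-twisted Courant bracket
`[X + ξ, Y + η]_H = [X, Y] + L_X η - ι_Y dξ + ι_Y ι_X H`, with `L_X η = ι_X dη + d(η(X))`. -/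
noncomputable def courantBracket (H : DForm m M 3) (s t : GenField m M) : GenField m M :=
  let X : VField m M := fun x => (s x).1
  let ξ : CovField m M := fun x => (s x).2
  let Y : VField m M := fun x => (t x).1
  let η : CovField m M := fun x => (t x).2
  fun x =>
    (mlieBracket (𝓡 m) X Y x,
      contract₂ (η.toForm.d x) (X x) + mvfderiv (𝓡 m) (fun y => η y (X y)) x
        - contract₂ (ξ.toForm.d x) (Y x) + contract₃ (H x) (X x) (Y x))

/-! ### Generalized complex and generalized Kähler structures -/

/-- The `√-1`-eigenbundle of `J` in the complexification of `TM ⊕ T*M` is closed under the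
(complexified) Courant bracket. A complex section `a + √-1 a'` is the pair `(a, a')` of real
sections, and it is a section of the eigenbundle if and only if `J a = -a'` and `J a' = a`. -/
def IsInvolutive (H : DForm m M 3) (J : GenEndo m M) : Prop :=
  ∀ a a' c c' : GenField m M,
    IsSmoothGenField a → IsSmoothGenField a' → IsSmoothGenField c → IsSmoothGenField c' →
    (∀ x, J x (a x) = -a' x ∧ J x (a' x) = a x) →
    (∀ x, J x (c x) = -c' x ∧ J x (c' x) = c x) →
    ∀ x,
      J x (courantBracket H a c x - courantBracket H a' c' x)
        = -(courantBracket H a c' x + courantBracket H a' c x) ∧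
      J x (courantBracket H a c' x + courantBracket H a' c x)
        = courantBracket H a c x - courantBracket H a' c' x

/-- Generalized complex structures on `TM ⊕ T*M` with the `H`-twisted Courant bracket. -/
structure IsGenComplex (H : DForm m M 3) (J : GenEndo m M) : Prop where
  smooth : ∀ s : GenField m M, IsSmoothGenField s → IsSmoothGenField fun x => J x (s x)
  sq : ∀ x u, J x (J x u) = -u
  orthogonal : ∀ x u v, genPairing (J x u) (J x v) = genPairing u v
  involutive : IsInvolutive H J

variable (H : DForm m M 3)

/-- Generalized Kähler structures on `TM ⊕ T*M` with the `H`-twisted Courant bracket. -/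
structure GenKahler where
  /-- the first generalized complex structure -/
  J₁ : GenEndo m M
  /-- the second generalized complex structure -/
  J₂ : GenEndo m M
  genComplex₁ : IsGenComplex H J₁
  genComplex₂ : IsGenComplex H J₂
  comm : ∀ x, J₁ x ∘ₗ J₂ x = J₂ x ∘ₗ J₁ x
  metric : ∀ x, IsGenMetric (-(J₁ x ∘ₗ J₂ x))

namespace GenKahler

variable {H} (K : GenKahler H)

instance (x : M) : FiniteDimensional ℝ (TangentSpace (𝓡 m) x) :=
  inferInstanceAs (FiniteDimensional ℝ (EuclideanSpace ℝ (Fin m)))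

instance (x : M) : T2Space (TangentSpace (𝓡 m) x) :=
  inferInstanceAs (T2Space (EuclideanSpace ℝ (Fin m)))

/-- The complex structure `J₊` of the biHermitian description. With `C₊` the `1`-eigenspace of
the generalized metric `-J₁ J₂`, it is `-J₁` on `C₊` transported to `TM` by the projection
`C₊ ≅ TM`. (Where the generalized metric is `X + ξ ↦ g⁻¹ξ + gX`, the space `C₊` is the graph of
`g`, and the tangent part of `J₁` is `-(J₊ + J₋)/2` on vectors and `-(J₊ - J₋)g⁻¹/2` on
covectors.) -/
noncomputable def Jplus (x : M) : TangentSpace (𝓡 m) x →ₗ[ℝ] TangentSpace (𝓡 m) x :=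
  -(LinearMap.fst ℝ _ _ ∘ₗ K.J₁ x ∘ₗ (K.metric x).lift 1 (by norm_num))

/-- The complex structure `J₋` of the biHermitian description: `-J₁` on the `(-1)`-eigenspace
`C₋` of the generalized metric, transported to `TM` by the projection `C₋ ≅ TM`. -/
noncomputable def Jminus (x : M) : TangentSpace (𝓡 m) x →ₗ[ℝ] TangentSpace (𝓡 m) x :=
  -(LinearMap.fst ℝ _ _ ∘ₗ K.J₁ x ∘ₗ (K.metric x).lift (-1) (by norm_num))

/-- The Poisson structure `β₁` of `J₁` as a map `T*M → TM`: the `T*M → TM` block of `J₁`. -/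
noncomputable def β₁ (x : M) : (TangentSpace (𝓡 m) x →L[ℝ] ℝ) →ₗ[ℝ] TangentSpace (𝓡 m) x :=
  LinearMap.fst ℝ _ _ ∘ₗ K.J₁ x ∘ₗ LinearMap.inr ℝ _ _

end GenKahler

/-! ### Symplectic forms and generalized Kähler structures of symplectic type -/

variable (m M) in
/-- Symplectic forms on `M`. -/
structure SymplecticForm where
  /-- the 2-form -/
  form : DForm m M 2
  smooth : IsSmoothForm form
  closed : form.d = 0
  nondegenerate : ∀ x X, (∀ Y, form x ![X, Y] = 0) → X = 0

/-- The generalized complex structure `X + ξ ↦ Ω⁻¹ ξ - Ω X` of a symplectic form. -/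
noncomputable def SymplecticForm.genEndo (Ω : SymplecticForm m M) : GenEndo m M := fun x =>
  symplecticEndo (Ω.form x) (Ω.nondegenerate x)

/-- `J₂ = e^{-b} J_Ω e^b`: the structure `J₂` is the B-transform of `J_Ω` by the 2-form `b`. -/
def GenKahler.IsSymplecticType {H : DForm m M 3} (K : GenKahler H) (Ω : SymplecticForm m M)
    (b : DForm m M 2) : Prop :=
  ∀ x, K.J₂ x = bTransform (-b x) ∘ₗ Ω.genEndo x ∘ₗ bTransform (b x)

end Manifold

/-! ### Torus actions -/

section Torus

/-- The torus of dimension `n`. Its Lie algebra is `Fin n → ℝ`. -/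
abbrev Torus (n : ℕ) := Fin n → Circle

/-- The exponential map of the torus. -/
noncomputable def torusExp {n : ℕ} (ς : Fin n → ℝ) : Torus n := fun i => Circle.exp (ς i)

variable {n m : ℕ} {M : Type*} [TopologicalSpace M]
  [ChartedSpace (EuclideanSpace ℝ (Fin m)) M] [IsManifold (𝓡 m) ∞ M] [MulAction (Torus n) M]

variable (m) in
/-- The differential at `x` of the action of `t` on `M`. -/
noncomputable def actionDeriv (t : Torus n) (x : M) :
    TangentSpace (𝓡 m) x →L[ℝ] TangentSpace (𝓡 m) (t • x) :=
  mfderiv (𝓡 m) (𝓡 m) (fun y : M => t • y) x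

variable (m M) in
/-- The fundamental vector field `X_ς(x) = d/ds (exp(sς) • x)` at `s = 0`. -/
noncomputable def fundField (ς : Fin n → ℝ) : VField m M := fun x =>
  mfderiv 𝓘(ℝ, ℝ) (𝓡 m) (fun s : ℝ => torusExp (s • ς) • x) 0 (1 : ℝ)

variable (n m) in
/-- The tangent space at `x` of the orbit of the torus. -/
noncomputable def orbitTangent (x : M) : Submodule ℝ (TangentSpace (𝓡 m) x) :=
  Submodule.span ℝ (Set.range fun ς : Fin n → ℝ => fundField m M ς x)

/-- Toric symplectic manifolds `(M, Ω, 𝕋, μ)`, with the sign convention `ι_{X_ς} Ω = -dμ_ς`. The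
action `𝕋 × M → M` is smooth if and only if its composition with the covering `exp` of `𝕋` is. -/
structure IsToricSymplectic {n : ℕ} {M : Type*} [TopologicalSpace M]
    [ChartedSpace (EuclideanSpace ℝ (Fin (2 * n))) M] [IsManifold (𝓡 (2 * n)) ∞ M]
    [MulAction (Torus n) M]
    (Ω : SymplecticForm (2 * n) M) (μ : M → StrongDual ℝ (Fin n → ℝ)) : Prop where
  smooth_action : ContMDiff (𝓘(ℝ, Fin n → ℝ).prod (𝓡 (2 * n))) (𝓡 (2 * n)) ∞
    fun p : (Fin n → ℝ) × M => torusExp p.1 • p.2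
  effective : ∀ t : Torus n, (∀ x : M, t • x = x) → t = 1
  symplectic : ∀ (t : Torus n) (x : M) (u v : TangentSpace (𝓡 (2 * n)) x),
    Ω.form (t • x) ![actionDeriv (2 * n) t x u, actionDeriv (2 * n) t x v] = Ω.form x ![u, v]
  smooth_moment : ContMDiff (𝓡 (2 * n)) 𝓘(ℝ, StrongDual ℝ (Fin n → ℝ)) ∞ μ
  invariant : ∀ (t : Torus n) (x : M), μ (t • x) = μ x
  moment : ∀ (ς : Fin n → ℝ) (x : M),
    contract₂ (Ω.form x) (fundField (2 * n) M ς x)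
      = -mvfderiv (𝓡 (2 * n)) (fun y => μ y ς) x

/-- `u'` is the image of `u` under the isomorphism `t_* ⊕ (t⁻¹)^*` from `T_xM ⊕ T_x*M` to
`T_{tx}M ⊕ T_{tx}*M`: this says `X' = t_* X` and `ξ = t^* ξ'`. -/
def IsTranslate (t : Torus n) (x : M) (u : GenTangent m x) (u' : GenTangent m (t • x)) : Prop :=
  u'.1 = actionDeriv m t x u.1 ∧ u.2 = u'.2.comp (actionDeriv m t x)

/-- Endomorphisms of `TM ⊕ T*M` that commute with the action of the torus. -/
def IsTorusInvariant (n : ℕ) [MulAction (Torus n) M] (J : GenEndo m M) : Prop :=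
  ∀ (t : Torus n) (x : M) u u', IsTranslate t x u u' → IsTranslate t x (J x u) (J (t • x) u')

/-- The infinitesimal extended action `ς ↦ X_ς - b(X_ς)` on a generalized Kähler manifold with
`J₂ = e^{-b} J_Ω e^b`. -/
noncomputable def extendedAction (b : DForm m M 2) (ς : Fin n → ℝ) : GenField m M := fun x =>
  (fundField m M ς x, -contract₂ (b x) (fundField m M ς x))

/-- `μ` is a moment map for the extended action `φ`: it is equivariant, and
`J₂ (φ_ς - √-1 dμ_ς) = √-1 (φ_ς - √-1 dμ_ς)`, written out in real and imaginary parts. -/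
structure IsHamiltonian {H : DForm m M 3} (K : GenKahler H) (φ : (Fin n → ℝ) → GenField m M)
    (μ : M → StrongDual ℝ (Fin n → ℝ)) : Prop where
  equivariant : ∀ (t : Torus n) (x : M), μ (t • x) = μ x
  moment_re : ∀ (ς : Fin n → ℝ) (x : M),
    K.J₂ x (φ ς x) = (0, mvfderiv (𝓡 m) (fun y => μ y ς) x)
  moment_im : ∀ (ς : Fin n → ℝ) (x : M),
    -K.J₂ x (0, mvfderiv (𝓡 m) (fun y => μ y ς) x) = φ ς x

/-- The extended action `φ` with moment map `μ` is strong Hamiltonian: it is Hamiltonian, and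
`β₁(dμ_ς, dμ_ζ) = 0`. -/
structure IsStrongHamiltonian {H : DForm m M 3} (K : GenKahler H)
    (φ : (Fin n → ℝ) → GenField m M) (μ : M → StrongDual ℝ (Fin n → ℝ)) : Prop
    extends IsHamiltonian K φ μ where
  poisson : ∀ (ς ζ : Fin n → ℝ) (x : M),
    mvfderiv (𝓡 m) (fun y => μ y ζ) x (K.β₁ x (mvfderiv (𝓡 m) (fun y => μ y ς) x)) = 0

/-- `J₊ 𝒟 = J₋ 𝒟` at the points of `S`, where `𝒟` is spanned by the tangent spaces of the
orbits. -/
def IsAntiDiagonalOn (n : ℕ) [MulAction (Torus n) M] {H : DForm m M 3} (K : GenKahler H)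
    (S : Set M) : Prop :=
  ∀ x ∈ S, (orbitTangent n m x).map (K.Jplus x) = (orbitTangent n m x).map (K.Jminus x)

/-- The preimage under the moment map of the interior of the moment polytope. -/
def momentInterior (μ : M → StrongDual ℝ (Fin n → ℝ)) : Set M :=
  μ ⁻¹' interior (Set.range μ)

end Torus

open Filter Topology

/-! ### Orthogonality for positive definite forms -/

section PosDef

variable {V : Type*} [AddCommGroup V] [Module ℝ V] {g : V →ₗ[ℝ] V →ₗ[ℝ] ℝ}

/-! Fix `x`, and let `g` be the inner product on the tangent space carried over from the eigenspace
`C₊`. Both `J₊` and `J₋` are `g`-orthogonal. If `u` is the gradient of a covector `ξ`, the tangent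
parts of `J₁ ξ` and `J₂ ξ` are `-(J₊ - J₋) u` and `-(J₊ + J₋) u`. Let `L` be the span of the
gradients of the components of `μ`. The moment map equation gives `𝒟 = (J₊ + J₋) L` with `J₊ + J₋`
injective, invariance of `μ` gives `𝒟 ⟂ L`, and the strong Hamiltonian condition is `(J₊ - J₋) L ⟂
L`. Given `𝒟 ⟂ L`, it says that `J₊ L` and `J₋ L` are both orthogonal to `L`.

If `𝒟` has dimension `n`, the orthogonal complement of `L` is `𝒟`. So the strong condition forces
`J₊ L = 𝒟 = J₋ L`, whence `J₊ 𝒟 = L = J₋ 𝒟`. Conversely, if `J₊ 𝒟 = J₋ 𝒟`, then `J₊ L` and `J₋ L`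
are the complement of the same space, so they agree; they contain `𝒟` and hence equal it, and `𝒟 ⟂
L`. This is `map_map_eq_iff`.

On smaller orbits the same argument runs inside the space `F` fixed by the infinitesimal isotropy,
once `dim F ≤ 2 dim L` is known (`IsGenMetric.map_range_eq_iff`). The isotropy algebra acts by
commuting skew endomorphisms that commute with `J₊`, faithfully because the action is effective
(`eq_zero_of_linAction`). It therefore has a vector `v` with injective orbit map
(`exists_injective_orbit`), and the orbit directions together with their images under `J₊` fill a
space orthogonal to `F`.

Thus the equivalence holds at every point. To pass from the open part to all of `M`, move from `x`
in the direction `v`: this reaches points with injective infinitesimal action, where `μ` is a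
submersion and so takes values in the interior of its image. Vanishing of the continuous functions
`β₁(dμ_ς, dμ_ζ)` extends to the closure. -/

theorem disjoint_of_orthogonal (hpos : ∀ u, u ≠ 0 → 0 < g u u) {S T : Submodule ℝ V}
    (h : ∀ u ∈ S, ∀ v ∈ T, g u v = 0) : Disjoint S T := by
  rw [Submodule.disjoint_def]
  intro u hS hT
  by_contra hu
  exact (hpos u hu).ne' (h u hS u hT)

variable [FiniteDimensional ℝ V]

theorem finrank_add_le_of_orthogonal (hpos : ∀ u, u ≠ 0 → 0 < g u u)
    {S T F : Submodule ℝ V} (h : ∀ u ∈ S, ∀ v ∈ T, g u v = 0) (hS : S ≤ F) (hT : T ≤ F) :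
    Module.finrank ℝ S + Module.finrank ℝ T ≤ Module.finrank ℝ F := by
  have h1 := Submodule.finrank_sup_add_finrank_inf_eq S T
  rw [(disjoint_of_orthogonal hpos h).eq_bot, finrank_bot, add_zero] at h1
  rw [← h1]
  exact Submodule.finrank_mono (sup_le hS hT)

/-- In a space of dimension at most `2k`, a subspace of dimension `k` has at most one orthogonal
subspace of dimension `k`. -/
theorem eq_of_orthogonal_of_finrank (hpos : ∀ u, u ≠ 0 → 0 < g u u)
    {S T P F : Submodule ℝ V} {k : ℕ} (hSP : ∀ u ∈ S, ∀ v ∈ P, g u v = 0)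
    (hTP : ∀ u ∈ T, ∀ v ∈ P, g u v = 0) (hS : S ≤ F) (hT : T ≤ F) (hP : P ≤ F)
    (dS : Module.finrank ℝ S = k) (dT : Module.finrank ℝ T = k) (dP : Module.finrank ℝ P = k)
    (dF : Module.finrank ℝ F ≤ 2 * k) : S = T := by
  have h : ∀ u ∈ S ⊔ T, ∀ v ∈ P, g u v = 0 := by
    intro u hu v hv
    obtain ⟨a, ha, c, hc, rfl⟩ := Submodule.mem_sup.mp hu
    simp [hSP a ha v hv, hTP c hc v hv]
  have h1 := finrank_add_le_of_orthogonal hpos h (sup_le hS hT) hP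
  have e1 : S = S ⊔ T := Submodule.eq_of_le_of_finrank_le le_sup_left (by omega)
  have e2 : T = S ⊔ T := Submodule.eq_of_le_of_finrank_le le_sup_right (by omega)
  exact e1.trans e2.symm

variable {S : Type*} [AddCommGroup S] [Module ℝ S] [FiniteDimensional ℝ S]

/-- A faithful commuting family of skew-symmetric endomorphisms is faithful on some vector. -/
theorem exists_injective_orbit (hpos : ∀ u, u ≠ 0 → 0 < g u u)
    (N : S →ₗ[ℝ] V →ₗ[ℝ] V) (hcomm : ∀ a c v, N a (N c v) = N c (N a v))
    (hskew : ∀ a u v, g (N a u) v = -g u (N a v)) (hinj : ∀ a, N a = 0 → a = 0) :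
    ∃ v, ∀ a, N a v = 0 → a = 0 := by
  -- Induction on the dimension of the kernel of `a ↦ N a v`, starting from `v = 0`. If some `a ≠ 0`
  -- kills `v`, choose `w` with `N a w ≠ 0`; replacing `v` by `v + N a w` strictly shrinks the
  -- kernel.
  have step : ∀ k : ℕ, ∀ v, Module.finrank ℝ (LinearMap.ker (N.flip v)) ≤ k →
      ∃ v, ∀ a, N a v = 0 → a = 0 := by
    intro k
    induction k with
    | zero =>
      intro v hv
      have h0 : LinearMap.ker (N.flip v) = ⊥ := Submodule.finrank_eq_zero.mp (by omega)
      refine ⟨v, fun a ha => ?_⟩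
      have : a ∈ LinearMap.ker (N.flip v) := by simpa using ha
      simpa [h0] using this
    | succ k ih =>
      intro v hv
      by_cases hall : ∀ a, N a v = 0 → a = 0
      · exact ⟨v, hall⟩
      push Not at hall
      obtain ⟨a, hav, ha⟩ := hall
      have hNa : N a ≠ 0 := fun h => ha (hinj a h)
      obtain ⟨w, hw⟩ : ∃ w, N a w ≠ 0 := by
        by_contra! h
        exact hNa (LinearMap.ext h)
      have haw : N a (N a w) ≠ 0 := by
        intro h
        refine (hpos _ hw).ne' ?_
        rw [hskew, h]; simp
      refine ih (v + N a w) ?_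
      have hlt : LinearMap.ker (N.flip (v + N a w)) < LinearMap.ker (N.flip v) := by
        have hle : ∀ c, N c (v + N a w) = 0 → N c v = 0 := by
          intro c hc
          by_contra hcv
          refine (hpos _ hcv).ne' ?_
          have h1 : N c v = -N c (N a w) := by
            rw [map_add] at hc; exact eq_neg_of_add_eq_zero_left hc
          -- Moving `N a` to the other side turns `N c v` into `N c (N a v) = 0`. So the two
          -- summands of `N c (v + N a w)` are orthogonal, and both vanish when the sum does.
          have h2 : g (N c v) (N c (N a w)) = 0 := by
            rw [hcomm c a, ← neg_eq_zero, ← hskew, hcomm a c, hav]; simp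
          rw [h1, map_neg, neg_eq_zero, ← h1]
          exact h2
        refine lt_of_le_of_ne (fun c hc => ?_) fun h => ?_
        · have hc' : N c (v + N a w) = 0 := by simpa using hc
          simpa using hle c hc'
        · have : a ∈ LinearMap.ker (N.flip (v + N a w)) := by
            rw [h]; simpa using hav
          rw [LinearMap.mem_ker, LinearMap.flip_apply, map_add, hav, zero_add] at this
          exact haw this
      have := Submodule.finrank_lt_finrank_of_lt hlt
      omega
  exact step _ 0 le_rfl

/-- The linear algebra of the equivalence between anti-diagonality and the strong Hamiltonian
condition: `P` and `Q` are two orthogonal complex structures, `L` is spanned by the gradients of the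
moment map, and its image under `P + Q` is the tangent space of the orbit. -/
theorem map_map_eq_iff (hsymm : ∀ u v, g u v = g v u) (hpos : ∀ u, u ≠ 0 → 0 < g u u)
    {P Q : V →ₗ[ℝ] V} (hP : ∀ u, P (P u) = -u) (hQ : ∀ u, Q (Q u) = -u)
    (hPg : ∀ u v, g (P u) (P v) = g u v) (hQg : ∀ u v, g (Q u) (Q v) = g u v)
    (hinj : ∀ u, P u + Q u = 0 → u = 0) {L F : Submodule ℝ V} (hLF : L ≤ F)
    (hPF : ∀ u ∈ F, P u ∈ F) (hQF : ∀ u ∈ F, Q u ∈ F)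
    (dF : Module.finrank ℝ F ≤ 2 * Module.finrank ℝ L)
    (hiso : ∀ u ∈ L, ∀ v ∈ L, g u (P v + Q v) = 0) :
    (L.map (P + Q)).map P = (L.map (P + Q)).map Q ↔ ∀ u ∈ L, ∀ v ∈ L, g u (P v - Q v) = 0 := by
  have injP : Function.Injective P := (injective_iff_map_eq_zero P).mpr fun u hu => by
    have := hP u; rw [hu, map_zero] at this; exact neg_eq_zero.mp this.symm
  have injQ : Function.Injective Q := (injective_iff_map_eq_zero Q).mpr fun u hu => by
    have := hQ u; rw [hu, map_zero] at this; exact neg_eq_zero.mp this.symm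
  have injA : Function.Injective (P + Q) := (injective_iff_map_eq_zero _).mpr hinj
  have dim : ∀ {f : V →ₗ[ℝ] V} (_ : Function.Injective f) (S : Submodule ℝ V),
      Module.finrank ℝ (S.map f) = Module.finrank ℝ S := fun {f} hf S =>
    (Submodule.equivMapOfInjective f hf S).finrank_eq.symm
  have mapF : ∀ {f : V →ₗ[ℝ] V} (_ : ∀ u ∈ F, f u ∈ F) {S : Submodule ℝ V} (_ : S ≤ F),
      S.map f ≤ F := fun hf S hS => Submodule.map_le_iff_le_comap.mpr fun u hu => hf u (hS hu)
  have hAF : ∀ u ∈ F, (P + Q) u ∈ F := fun u hu => F.add_mem (hPF u hu) (hQF u hu)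
  have back : ∀ {f : V →ₗ[ℝ] V} (_ : ∀ u, f (f u) = -u) (S : Submodule ℝ V),
      (S.map f).map f = S := by
    intro f hf S
    ext u
    simp only [Submodule.mem_map, exists_exists_and_eq_and, hf]
    exact ⟨fun ⟨a, ha, e⟩ => e ▸ S.neg_mem ha, fun hu => ⟨-u, S.neg_mem hu, neg_neg u⟩⟩
  set D := L.map (P + Q) with hD
  have dD : Module.finrank ℝ D = Module.finrank ℝ L := dim injA L
  have hDF : D ≤ F := mapF hAF hLF
  have hDL : ∀ u ∈ D, ∀ v ∈ L, g u v = 0 := by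
    rintro _ ⟨u, hu, rfl⟩ v hv
    rw [hsymm]
    exact hiso v hv u hu
  constructor
  · intro h
    -- `P` and `Q` are isometries, so `P L ⟂ P D` and `Q L ⟂ Q D = P D`; the dimension bound on `F`
    -- leaves room for only one such subspace.
    have e1 : L.map P = L.map Q := by
      refine eq_of_orthogonal_of_finrank hpos (P := D.map P) (F := F) ?_ ?_ (mapF hPF hLF)
        (mapF hQF hLF) (mapF hPF hDF) (dim injP L) (dim injQ L) ((dim injP D).trans dD) dF
      · rintro _ ⟨u, hu, rfl⟩ _ ⟨v, hv, rfl⟩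
        rw [hPg, hsymm]
        exact hDL v hv u hu
      · rw [h]
        rintro _ ⟨u, hu, rfl⟩ _ ⟨v, hv, rfl⟩
        rw [hQg, hsymm]
        exact hDL v hv u hu
    have e2 : D = L.map P := by
      refine Submodule.eq_of_le_of_finrank_eq ?_ (dD.trans (dim injP L).symm)
      rintro _ ⟨u, hu, rfl⟩
      exact Submodule.add_mem _ ⟨u, hu, rfl⟩ (e1 ▸ ⟨u, hu, rfl⟩)
    intro u hu v hv
    rw [map_sub, hsymm u, hsymm u, hDL (P v) (e2 ▸ ⟨v, hv, rfl⟩) u hu,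
      hDL (Q v) (e2 ▸ e1 ▸ ⟨v, hv, rfl⟩) u hu, sub_zero]
  · intro h
    -- Both `(P + Q) L` and `(P - Q) L` are orthogonal to `L`, hence so are `P L` and `Q L`.
    have hp : ∀ u ∈ L.map P, ∀ v ∈ L, g u v = 0 := by
      rintro _ ⟨u, hu, rfl⟩ v hv
      have h1 := h v hv u hu
      have h2 := hiso v hv u hu
      rw [map_sub] at h1
      rw [map_add] at h2
      rw [hsymm]
      linarith
    have hq : ∀ u ∈ L.map Q, ∀ v ∈ L, g u v = 0 := by
      rintro _ ⟨u, hu, rfl⟩ v hv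
      have h1 := h v hv u hu
      have h2 := hiso v hv u hu
      rw [map_sub] at h1
      rw [map_add] at h2
      rw [hsymm]
      linarith
    have e1 : L.map P = D := eq_of_orthogonal_of_finrank hpos hp hDL (mapF hPF hLF) hDF hLF
      (dim injP L) dD rfl dF
    have e2 : L.map Q = D := eq_of_orthogonal_of_finrank hpos hq hDL (mapF hQF hLF) hDF hLF
      (dim injQ L) dD rfl dF
    rw [← e1, back hP, e1, ← e2, back hQ]

end PosDef

/-! ### The biHermitian linear algebra of a generalized metric -/

namespace IsGenMetric

variable {V : Type*} [AddCommGroup V] [Module ℝ V] [TopologicalSpace V]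
  [IsTopologicalAddGroup V] [ContinuousSMul ℝ V] [T2Space V] [FiniteDimensional ℝ V]

section Metric

variable {G : (V × (V →L[ℝ] ℝ)) →ₗ[ℝ] (V × (V →L[ℝ] ℝ))} (hG : IsGenMetric G)
  {ε : ℝ} {hε : ε * ε = 1}

theorem fst_lift (X : V) : (hG.lift ε hε X).1 = X :=
  (LinearEquiv.ofBijective _ (hG.proj_bijective ε hε)).apply_symm_apply X

theorem apply_lift (X : V) : G (hG.lift ε hε X) = ε • hG.lift ε hε X := by
  have := ((LinearEquiv.ofBijective _ (hG.proj_bijective ε hε)).symm X).2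
  exact sub_eq_zero.mp (LinearMap.mem_ker.mp this)

theorem lift_unique {u : V × (V →L[ℝ] ℝ)} (hu : G u = ε • u) : hG.lift ε hε u.1 = u := by
  have hu' : u ∈ LinearMap.ker (G - ε • LinearMap.id) := by simp [hu]
  have := (LinearEquiv.ofBijective _ (hG.proj_bijective ε hε)).symm_apply_apply ⟨u, hu'⟩
  exact congrArg Subtype.val this

/-- The inner product on `V` induced from the eigenspace `C₊`. -/
noncomputable def tangentMetric : V →ₗ[ℝ] V →ₗ[ℝ] ℝ :=
  LinearMap.mk₂ ℝ
    (fun X Y => genPairing (hG.lift 1 (by norm_num) X) (hG.lift 1 (by norm_num) Y))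
    (by intros; simp [genPairing]; ring) (by intros; simp [genPairing]; ring)
    (by intros; simp [genPairing]; ring) (by intros; simp [genPairing]; ring)

theorem tangentMetric_apply (X Y : V) : hG.tangentMetric X Y =
    genPairing (hG.lift 1 (by norm_num) X) (hG.lift 1 (by norm_num) Y) := rfl

theorem genPairing_comm (u v : V × (V →L[ℝ] ℝ)) : genPairing u v = genPairing v u := by
  simp [genPairing, add_comm]

theorem tangentMetric_comm (X Y : V) : hG.tangentMetric X Y = hG.tangentMetric Y X := by
  rw [tangentMetric_apply, genPairing_comm, tangentMetric_apply]

theorem tangentMetric_pos (X : V) (hX : X ≠ 0) : 0 < hG.tangentMetric X X := by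
  have h := hG.posDef (hG.lift 1 (by norm_num) X) fun h => hX (by
    rw [← hG.fst_lift (ε := 1) (hε := by norm_num) X, h]; rfl)
  rwa [apply_lift, one_smul] at h

theorem genPairing_lift_lift_neg (X Y : V) :
    genPairing (hG.lift 1 (by norm_num) X) (hG.lift (-1) (by norm_num) Y) = 0 := by
  have h := hG.selfAdjoint (hG.lift 1 (by norm_num) X) (hG.lift (-1) (by norm_num) Y)
  rw [apply_lift, apply_lift] at h
  simp [genPairing] at h ⊢
  linarith

/-- `C₊` and `C₋` are graphs over `V` that are orthogonal to each other; adding the two cross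
relations shows that they induce opposite inner products. -/
theorem genPairing_lift_neg (X Y : V) :
    genPairing (hG.lift (-1) (by norm_num) X) (hG.lift (-1) (by norm_num) Y)
      = -hG.tangentMetric X Y := by
  have h1 := hG.genPairing_lift_lift_neg X Y
  have h2 := hG.genPairing_lift_lift_neg Y X
  rw [tangentMetric_apply]
  simp only [genPairing, fst_lift] at h1 h2 ⊢
  linarith

/-- The metric dual of a covector. -/
noncomputable def sharp (_hG : IsGenMetric G) : (V →L[ℝ] ℝ) →ₗ[ℝ] V :=
  (1 / 2 : ℝ) • (LinearMap.fst ℝ V (V →L[ℝ] ℝ) ∘ₗ G ∘ₗ LinearMap.inr ℝ V (V →L[ℝ] ℝ))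

/-- The components of a covector `u` in `C₊` and `C₋` are `(u + G u) / 2` and `(u - G u) / 2`. Their
tangent parts are opposite because `u` has none. -/
theorem inr_eq_lift_sharp (ξ : V →L[ℝ] ℝ) :
    ((0, ξ) : V × (V →L[ℝ] ℝ)) = hG.lift 1 (by norm_num) (hG.sharp ξ)
      - hG.lift (-1) (by norm_num) (hG.sharp ξ) := by
  have h1 : hG.lift 1 (by norm_num) (hG.sharp ξ)
      = (1 / 2 : ℝ) • (((0, ξ) : V × (V →L[ℝ] ℝ)) + G (0, ξ)) := by
    rw [← hG.lift_unique (ε := 1) (hε := by norm_num)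
      (u := (1 / 2 : ℝ) • (((0, ξ) : V × (V →L[ℝ] ℝ)) + G (0, ξ)))
      (by rw [map_smul, map_add, hG.sq]; module)]
    simp [sharp]
  have h2 : hG.lift (-1) (by norm_num) (hG.sharp ξ)
      = (1 / 2 : ℝ) • (G (0, ξ) - ((0, ξ) : V × (V →L[ℝ] ℝ))) := by
    rw [← hG.lift_unique (ε := -1) (hε := by norm_num)
      (u := (1 / 2 : ℝ) • (G (0, ξ) - ((0, ξ) : V × (V →L[ℝ] ℝ))))
      (by rw [map_smul, map_sub, hG.sq]; module)]
    simp [sharp]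
  rw [h1, h2]
  module

theorem tangentMetric_sharp (ξ : V →L[ℝ] ℝ) (Z : V) : hG.tangentMetric (hG.sharp ξ) Z = ξ Z := by
  have h : genPairing ((0, ξ) : V × (V →L[ℝ] ℝ)) (hG.lift 1 (by norm_num) Z) = ξ Z := by
    simp [genPairing, fst_lift]
  have h2 := hG.genPairing_lift_lift_neg Z (hG.sharp ξ)
  have h3 : ∀ u v w : V × (V →L[ℝ] ℝ), genPairing (u - v) w = genPairing u w - genPairing w v := by
    intro u v w
    simp [genPairing]
    ring
  rw [← h, hG.inr_eq_lift_sharp, h3, h2, sub_zero, tangentMetric_apply]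

end Metric

/-! ### The pair `J₊`, `J₋` in terms of `J₁` and `J₂` -/

section Hermitian

variable {J₁ J₂ : (V × (V →L[ℝ] ℝ)) →ₗ[ℝ] (V × (V →L[ℝ] ℝ))}
  (hG : IsGenMetric (-(J₁ ∘ₗ J₂))) (ε : ℝ) (hε : ε * ε = 1)

/-- The operator `-J₁` on the `ε`-eigenspace of `-J₁ J₂`, transported to `V`. -/
noncomputable def tangentStr : V →ₗ[ℝ] V :=
  -(LinearMap.fst ℝ V (V →L[ℝ] ℝ) ∘ₗ J₁ ∘ₗ hG.lift ε hε)

variable (hcomm : ∀ u, J₁ (J₂ u) = J₂ (J₁ u)) (hsq : ∀ u, J₁ (J₁ u) = -u)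

include hcomm in
-- `J₁` commutes with `-J₁ J₂`, so it preserves the eigenspaces `C_±`.
theorem apply₁_lift (X : V) :
    J₁ (hG.lift ε hε X) = -hG.lift ε hε (hG.tangentStr ε hε X) := by
  have h1 : -J₁ (J₂ (hG.lift ε hε X)) = ε • hG.lift ε hε X := hG.apply_lift X
  have h : (-(J₁ ∘ₗ J₂)) (J₁ (hG.lift ε hε X)) = ε • J₁ (hG.lift ε hε X) := by
    simp only [LinearMap.neg_apply, LinearMap.comp_apply]
    rw [← hcomm, ← map_neg, h1, map_smul]
  rw [← hG.lift_unique (hε := hε) h, ← map_neg]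
  simp [tangentStr]

include hcomm hsq in
theorem apply₂_lift (X : V) :
    J₂ (hG.lift ε hε X) = -(ε • hG.lift ε hε (hG.tangentStr ε hε X)) := by
  have h1 : -J₁ (J₂ (hG.lift ε hε X)) = ε • hG.lift ε hε X := hG.apply_lift X
  have h2 := congrArg J₁ h1
  rw [map_neg, hsq, neg_neg, map_smul, hG.apply₁_lift ε hε hcomm] at h2
  rw [h2, smul_neg]

include hcomm hsq in
theorem tangentStr_sq (X : V) : hG.tangentStr ε hε (hG.tangentStr ε hε X) = -X := by
  have h := hsq (hG.lift ε hε X)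
  rw [hG.apply₁_lift ε hε hcomm, map_neg, hG.apply₁_lift ε hε hcomm, neg_neg] at h
  have := congrArg Prod.fst h
  rwa [fst_lift, Prod.fst_neg, fst_lift] at this

variable (horth : ∀ u v, genPairing (J₁ u) (J₁ v) = genPairing u v)

include hcomm horth in
theorem tangentMetric_plus (X Y : V) :
    hG.tangentMetric (hG.tangentStr 1 (by norm_num) X) (hG.tangentStr 1 (by norm_num) Y)
      = hG.tangentMetric X Y := by
  have h := horth (hG.lift 1 (by norm_num) X) (hG.lift 1 (by norm_num) Y)
  rw [hG.apply₁_lift 1 _ hcomm, hG.apply₁_lift 1 _ hcomm] at h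
  rw [tangentMetric_apply, tangentMetric_apply, ← h]
  simp [genPairing]

include hcomm horth in
theorem tangentMetric_minus (X Y : V) :
    hG.tangentMetric (hG.tangentStr (-1) (by norm_num) X) (hG.tangentStr (-1) (by norm_num) Y)
      = hG.tangentMetric X Y := by
  have h := horth (hG.lift (-1) (by norm_num) X) (hG.lift (-1) (by norm_num) Y)
  rw [hG.apply₁_lift (-1) _ hcomm, hG.apply₁_lift (-1) _ hcomm, genPairing_lift_neg] at h
  rw [← neg_inj, ← genPairing_lift_neg, ← h]
  simp [genPairing]

include hcomm in
-- On `C_±` one has `J₂ = ±J₁`. Hence splitting a covector along `C₊` and `C₋` produces the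
-- difference of the two structures for `J₁` and the sum for `J₂`.
theorem fst_apply₁_inr (ξ : V →L[ℝ] ℝ) : (J₁ (0, ξ)).1
    = -(hG.tangentStr 1 (by norm_num) (hG.sharp ξ)
      - hG.tangentStr (-1) (by norm_num) (hG.sharp ξ)) := by
  rw [hG.inr_eq_lift_sharp ξ, map_sub, hG.apply₁_lift 1 _ hcomm, hG.apply₁_lift (-1) _ hcomm]
  simp only [Prod.fst_sub, Prod.fst_neg, fst_lift]
  abel

include hcomm hsq in
theorem fst_apply₂_inr (ξ : V →L[ℝ] ℝ) : (J₂ (0, ξ)).1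
    = -(hG.tangentStr 1 (by norm_num) (hG.sharp ξ)
      + hG.tangentStr (-1) (by norm_num) (hG.sharp ξ)) := by
  rw [hG.inr_eq_lift_sharp ξ, map_sub, hG.apply₂_lift 1 _ hcomm hsq,
    hG.apply₂_lift (-1) _ hcomm hsq]
  simp only [Prod.fst_sub, Prod.fst_neg, Prod.smul_fst, fst_lift]
  module

/-- `u'` is the image of `u` under `E ⊕ (E⁻¹)^*`. -/
def IsPushforward (E : V →L[ℝ] V) (u u' : V × (V →L[ℝ] ℝ)) : Prop :=
  u'.1 = E u.1 ∧ u.2 = u'.2.comp E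

variable {E E' : V →L[ℝ] V} (hE : ∀ v, E (E' v) = v) (hE' : ∀ v, E' (E v) = v)
  (h₁ : ∀ u u', IsPushforward E u u' → IsPushforward E (J₁ u) (J₁ u'))
  (h₂ : ∀ u u', IsPushforward E u u' → IsPushforward E (J₂ u) (J₂ u'))

include hE hE' h₁ h₂ in
-- A symmetry of `J₁` and `J₂` preserves `-J₁ J₂` and its eigenspaces, so it carries the unique lift
-- of `X` to the unique lift of `E X`.
theorem isPushforward_lift (X : V) :
    IsPushforward E (hG.lift ε hε X) (hG.lift ε hε (E X)) := by
  set u := hG.lift ε hε X with hu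
  have hp : IsPushforward E u (E X, u.2.comp E') := by
    refine ⟨by rw [hu, fst_lift], ?_⟩
    ext v
    simp [hE']
  have h := h₁ _ _ (h₂ _ _ hp)
  have hu1 : -J₁ (J₂ u) = ε • u := hG.apply_lift X
  rw [neg_eq_iff_eq_neg.mp hu1] at h
  have key : (-(J₁ ∘ₗ J₂)) (E X, u.2.comp E') = ε • (E X, u.2.comp E') := by
    obtain ⟨ha, hb⟩ := h
    simp only [Prod.fst_neg, Prod.snd_neg, Prod.smul_fst, Prod.smul_snd, map_neg, map_smul] at ha hb
    refine Prod.ext ?_ (ContinuousLinearMap.ext fun v => ?_)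
    · have hX : u.1 = X := hG.fst_lift X
      simp [ha, hX]
    · have := DFunLike.congr_fun hb (E' v)
      simp [hE] at this
      simp [← this]
  have := hG.lift_unique (hε := hε) key
  rw [this]
  exact hp

include hE hE' h₁ h₂ in
theorem tangentStr_map (X : V) :
    hG.tangentStr ε hε (E X) = E (hG.tangentStr ε hε X) := by
  have h := (h₁ _ _ (hG.isPushforward_lift ε hε hE hE' h₁ h₂ X)).1
  simp [tangentStr, h]

include hE hE' h₁ h₂ in
theorem tangentMetric_map (X Y : V) :
    hG.tangentMetric (E X) (E Y) = hG.tangentMetric X Y := by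
  have hX := hG.isPushforward_lift 1 (by norm_num) hE hE' h₁ h₂ X
  have hY := hG.isPushforward_lift 1 (by norm_num) hE hE' h₁ h₂ Y
  rw [tangentMetric_apply, tangentMetric_apply]
  simp only [genPairing, hX.2, hY.2, fst_lift, ContinuousLinearMap.comp_apply]

variable {T : Type*} [AddCommGroup T] [Module ℝ T] [FiniteDimensional ℝ T]

include hcomm hsq horth in
/-- The equivalence of the strong Hamiltonian condition and anti-diagonality at a point. The maps
`X` and `α` are the infinitesimal action and the differential of the moment map, and `N` is the
infinitesimal isotropy representation. -/
theorem map_range_eq_iff (X : T →ₗ[ℝ] V) (α : T →ₗ[ℝ] (V →L[ℝ] ℝ))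
    (hX : ∀ s, X s = -(J₂ (0, α s)).1) (hnd : ∀ ξ : V →L[ℝ] ℝ, (J₂ (0, ξ)).1 = 0 → ξ = 0)
    (hiso : ∀ s r, α s (X r) = 0) (N : LinearMap.ker X →ₗ[ℝ] V →ₗ[ℝ] V)
    (hNcomm : ∀ a c v, N a (N c v) = N c (N a v))
    (hNskew : ∀ a u v, hG.tangentMetric (N a u) v = -hG.tangentMetric u (N a v))
    (hNinj : ∀ a, N a = 0 → a = 0)
    (hNp : ∀ a v, N a (hG.tangentStr 1 (by norm_num) v) = hG.tangentStr 1 (by norm_num) (N a v))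
    (hNm : ∀ a v,
      N a (hG.tangentStr (-1) (by norm_num) v) = hG.tangentStr (-1) (by norm_num) (N a v))
    (hNX : ∀ a s, N a (X s) = 0) (hdim : Module.finrank ℝ V = 2 * Module.finrank ℝ T) :
    (LinearMap.range X).map (hG.tangentStr 1 (by norm_num))
        = (LinearMap.range X).map (hG.tangentStr (-1) (by norm_num)) ↔
      ∀ s r, α r (J₁ (0, α s)).1 = 0 := by
  set P := hG.tangentStr 1 (by norm_num) with hP
  set Q := hG.tangentStr (-1) (by norm_num) with hQ
  set g := hG.tangentMetric with hg
  have hpos := hG.tangentMetric_pos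
  have hXY : X = (P + Q) ∘ₗ (hG.sharp ∘ₗ α) := by
    ext s
    rw [hX, hG.fst_apply₂_inr hcomm hsq, neg_neg]
    rfl
  -- Every `u` is the gradient of `g u`, and `P + Q` on gradients is minus the covector-to-vector
  -- block of `J₂`, which is injective.
  have hinj : ∀ u, P u + Q u = 0 → u = 0 := by
    intro u hu
    let ξ : V →L[ℝ] ℝ := (g u).toContinuousLinearMap
    have hξ : hG.sharp ξ = u := by
      by_contra hne
      have h0 : ∀ Z, g (hG.sharp ξ - u) Z = 0 := by
        intro Z
        rw [map_sub, LinearMap.sub_apply, hg, tangentMetric_sharp]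
        simp [ξ, hg]
      exact (hpos _ (sub_ne_zero.mpr hne)).ne' (h0 _)
    have h0 := hnd ξ (by rw [hG.fst_apply₂_inr hcomm hsq, hξ, hu, neg_zero])
    rw [← hξ, h0, map_zero]
  set L := LinearMap.range (hG.sharp ∘ₗ α) with hL
  have hXL : LinearMap.range X = L.map (P + Q) := by rw [hXY, LinearMap.range_comp]
  have injA : Function.Injective (P + Q) := (injective_iff_map_eq_zero _).mpr hinj
  have dL : Module.finrank ℝ (LinearMap.range X) = Module.finrank ℝ L := by
    rw [hXL]
    exact (Submodule.equivMapOfInjective _ injA L).finrank_eq.symm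
  let F : Submodule ℝ V := ⨅ a, LinearMap.ker (N a)
  have memF : ∀ u, u ∈ F ↔ ∀ a, N a u = 0 := by simp [F]
  obtain ⟨v, hv⟩ := exists_injective_orbit hpos N hNcomm hNskew hNinj
  -- `W` and `P W`, with `W` the orbit directions of the generic `v`, are independent and orthogonal
  -- to `F`. So `dim F ≤ 2 dim T - 2 dim ker X`, which is twice the rank of `X`.
  have dF : Module.finrank ℝ F ≤ 2 * Module.finrank ℝ L := by
    have injP : Function.Injective P := (injective_iff_map_eq_zero P).mpr fun u hu => by
      have := hG.tangentStr_sq 1 (by norm_num) hcomm hsq u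
      rw [← hP, hu, map_zero] at this; exact neg_eq_zero.mp this.symm
    have injv : Function.Injective (N.flip v) :=
      (injective_iff_map_eq_zero _).mpr fun a ha => hv a (by simpa using ha)
    set W := LinearMap.range (N.flip v) with hW
    have dW : Module.finrank ℝ W = Module.finrank ℝ (LinearMap.ker X) :=
      LinearMap.finrank_range_of_inj injv
    have dPW : Module.finrank ℝ (W.map P) = Module.finrank ℝ W :=
      (Submodule.equivMapOfInjective _ injP W).finrank_eq.symm
    have o1 : ∀ u ∈ W, ∀ w ∈ W.map P, g u w = 0 := by
      rintro _ ⟨a, rfl⟩ _ ⟨_, ⟨c, rfl⟩, rfl⟩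
      simp only [LinearMap.flip_apply]
      have hskew : ∀ u w, g (P u) w = -g u (P w) := by
        intro u w
        rw [← hG.tangentMetric_plus hcomm horth, ← hP, hG.tangentStr_sq 1 _ hcomm hsq]
        simp [hg]
      -- The operator `N a ∘ N c` is symmetric and commutes with the skew operator `P`, so their
      -- product is skew and has zero quadratic form at `v`.
      have e1 : g (N a v) (P (N c v)) = -g v (P (N a (N c v))) := by rw [hNskew, hNp]
      have e2 : g (N a v) (P (N c v)) = g v (P (N a (N c v))) := by
        rw [hG.tangentMetric_comm, hskew, hNskew, neg_neg, hNp, hNcomm]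
      linarith
    have o2 : ∀ u ∈ F, ∀ w ∈ W ⊔ W.map P, g u w = 0 := by
      intro u hu w hw
      have hu' := (memF u).mp hu
      obtain ⟨_, ⟨a, rfl⟩, _, ⟨_, ⟨c, rfl⟩, rfl⟩, rfl⟩ := Submodule.mem_sup.mp hw
      simp only [LinearMap.flip_apply, map_add]
      rw [← hNp, ← neg_neg (g u (N a v)), ← hNskew, hu', ← neg_neg (g u (N c (P v))), ← hNskew, hu']
      simp
    have d1 := finrank_add_le_of_orthogonal hpos o2 le_top le_top
    have d2 := Submodule.finrank_sup_add_finrank_inf_eq W (W.map P)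
    rw [(disjoint_of_orthogonal hpos o1).eq_bot, finrank_bot, add_zero] at d2
    have d3 := LinearMap.finrank_range_add_finrank_ker X
    rw [finrank_top] at d1
    omega
  have hPF : ∀ u ∈ F, P u ∈ F := fun u hu => (memF _).mpr fun a => by
    rw [hNp, (memF u).mp hu, map_zero]
  have hQF : ∀ u ∈ F, Q u ∈ F := fun u hu => (memF _).mpr fun a => by
    rw [hNm, (memF u).mp hu, map_zero]
  have hLF : L ≤ F := by
    rintro _ ⟨s, rfl⟩
    refine (memF _).mpr fun a => hinj _ ?_
    rw [← hNp, ← hNm, ← map_add]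
    exact (congrArg (N a) (LinearMap.congr_fun hXY s)).symm.trans (hNX a s)
  have hiso' : ∀ u ∈ L, ∀ w ∈ L, g u (P w + Q w) = 0 := by
    rintro _ ⟨s, rfl⟩ _ ⟨r, rfl⟩
    exact (hG.tangentMetric_sharp _ _).trans
      ((congrArg (α s) (LinearMap.congr_fun hXY r)).symm.trans (hiso s r))
  rw [hXL, map_map_eq_iff hG.tangentMetric_comm hpos (hG.tangentStr_sq 1 _ hcomm hsq)
    (hG.tangentStr_sq (-1) _ hcomm hsq) (hG.tangentMetric_plus hcomm horth)
    (hG.tangentMetric_minus hcomm horth) hinj hLF hPF hQF dF hiso']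
  have hval : ∀ s r, α r (J₁ (0, α s)).1
      = -g (hG.sharp (α r)) (P (hG.sharp (α s)) - Q (hG.sharp (α s))) := by
    intro s r
    rw [hG.fst_apply₁_inr hcomm, map_neg, hG.tangentMetric_sharp]
  constructor
  · intro h s r
    exact (hval s r).trans (neg_eq_zero.mpr (h _ ⟨r, rfl⟩ _ ⟨s, rfl⟩))
  · rintro h _ ⟨r, rfl⟩ _ ⟨s, rfl⟩
    have := h s r
    rw [hval] at this
    exact neg_eq_zero.mp this

end Hermitian

end IsGenMetric

/-! ### Torus actions in a chart -/

section TorusExp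

variable {n : ℕ}

theorem torusExp_zero : torusExp (0 : Fin n → ℝ) = 1 := by
  ext i; simp [torusExp]

theorem torusExp_add (ς ζ : Fin n → ℝ) : torusExp (ς + ζ) = torusExp ς * torusExp ζ := by
  funext i; simp [torusExp, Circle.exp_add]

theorem exists_torusExp_eq (t : Torus n) :
    ∃ ς ∈ Metric.closedBall (0 : Fin n → ℝ) Real.pi, torusExp ς = t := by
  refine ⟨fun i => Complex.arg (t i), ?_, funext fun i => Circle.exp_arg (t i)⟩
  rw [mem_closedBall_zero_iff, pi_norm_le_iff_of_nonneg Real.pi_pos.le]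
  exact fun i => Complex.abs_arg_le_pi _

/-- A one-parameter subgroup of the torus is trivial only if its generator vanishes. -/
theorem eq_zero_of_torusExp_smul {ς : Fin n → ℝ} (h : ∀ s : ℝ, torusExp (s • ς) = 1) : ς = 0 := by
  funext i
  by_contra hi
  have h1 := congrFun (h (Real.pi / ς i)) i
  have h2 : (Real.pi / ς i) * ς i = Real.pi := div_mul_cancel₀ _ hi
  simp only [torusExp, Pi.smul_apply, smul_eq_mul, h2, Pi.one_apply] at h1
  have h3 := congrArg (fun z : Circle => (z : ℂ)) h1
  simp [Circle.coe_exp, Complex.exp_pi_mul_I] at h3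
  norm_num at h3

end TorusExp

section ChartAction

variable {n m : ℕ} {M : Type*} [TopologicalSpace M]
  [ChartedSpace (EuclideanSpace ℝ (Fin m)) M] [IsManifold (𝓡 m) ∞ M] [MulAction (Torus n) M]

variable (n m) in
/-- The action of the torus in the chart centred at `x`. -/
noncomputable def chartAction (x : M) (p : (Fin n → ℝ) × EuclideanSpace ℝ (Fin m)) :
    EuclideanSpace ℝ (Fin m) :=
  extChartAt (𝓡 m) x (torusExp p.1 • (extChartAt (𝓡 m) x).symm p.2)

variable (n m) in
/-- The points at which the chart centred at `x` describes the action of the torus. -/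
def chartDomain (x : M) : Set ((Fin n → ℝ) × EuclideanSpace ℝ (Fin m)) :=
  {p | p.2 ∈ (extChartAt (𝓡 m) x).target ∧
    torusExp p.1 • (extChartAt (𝓡 m) x).symm p.2 ∈ (extChartAt (𝓡 m) x).source}

theorem mem_chartDomain {x y : M} {ς : Fin n → ℝ} (hy : y ∈ (extChartAt (𝓡 m) x).source)
    (h : torusExp ς • y ∈ (extChartAt (𝓡 m) x).source) :
    (ς, extChartAt (𝓡 m) x y) ∈ chartDomain n m x := by
  refine ⟨(extChartAt (𝓡 m) x).map_source hy, ?_⟩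
  rwa [(extChartAt (𝓡 m) x).left_inv hy]

theorem mem_chartDomain_zero {x y : M} (hy : y ∈ (extChartAt (𝓡 m) x).source) :
    ((0 : Fin n → ℝ), extChartAt (𝓡 m) x y) ∈ chartDomain n m x :=
  mem_chartDomain hy (by rwa [torusExp_zero, one_smul])

theorem chartAction_apply {x y : M} {ς : Fin n → ℝ} (hy : y ∈ (extChartAt (𝓡 m) x).source) :
    chartAction n m x (ς, extChartAt (𝓡 m) x y) = extChartAt (𝓡 m) x (torusExp ς • y) := by
  simp only [chartAction, (extChartAt (𝓡 m) x).left_inv hy]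

/-- Smoothness of the torus action. -/
def IsSmoothAction (n m : ℕ) (M : Type*) [TopologicalSpace M]
    [ChartedSpace (EuclideanSpace ℝ (Fin m)) M] [MulAction (Torus n) M] : Prop :=
  ContMDiff (𝓘(ℝ, Fin n → ℝ).prod (𝓡 m)) (𝓡 m) ∞ fun p : (Fin n → ℝ) × M => torusExp p.1 • p.2

variable (hsm : IsSmoothAction n m M)
include hsm

theorem contMDiff_smul (t : Torus n) : ContMDiff (𝓡 m) (𝓡 m) ∞ fun y : M => t • y := by
  obtain ⟨ς, -, rfl⟩ := exists_torusExp_eq t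
  exact hsm.comp (f := fun y : M => (ς, y)) (contMDiff_const.prodMk contMDiff_id)

theorem contMDiff_orbit (ς : Fin n → ℝ) (y : M) :
    ContMDiff 𝓘(ℝ, ℝ) (𝓡 m) ∞ fun s : ℝ => torusExp (s • ς) • y := by
  refine hsm.comp (f := fun s : ℝ => (s • ς, y)) (ContMDiff.prodMk ?_ contMDiff_const)
  exact (contDiff_id.smul contDiff_const).contMDiff

theorem continuous_torusExp_smul :
    Continuous fun p : (Fin n → ℝ) × M => torusExp p.1 • p.2 := hsm.continuous

theorem isOpen_chartDomain (x : M) : IsOpen (chartDomain n m x) := by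
  have h1 : ContinuousOn (fun p : (Fin n → ℝ) × EuclideanSpace ℝ (Fin m) =>
      torusExp p.1 • (extChartAt (𝓡 m) x).symm p.2) {p | p.2 ∈ (extChartAt (𝓡 m) x).target} := by
    refine (continuous_torusExp_smul hsm).comp_continuousOn
      (continuous_fst.continuousOn.prodMk ?_)
    exact (continuousOn_extChartAt_symm x).comp continuous_snd.continuousOn fun p hp => hp
  exact h1.isOpen_inter_preimage ((isOpen_extChartAt_target x).preimage continuous_snd)
    (isOpen_extChartAt_source x)

theorem contDiffAt_chartAction {x : M} {p : (Fin n → ℝ) × EuclideanSpace ℝ (Fin m)}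
    (hp : p ∈ chartDomain n m x) : ContDiffAt ℝ ∞ (chartAction n m x) p := by
  rw [← contMDiffAt_iff_contDiffAt]
  have h1 : ContMDiffAt (𝓡 m) 𝓘(ℝ, EuclideanSpace ℝ (Fin m)) ∞ (extChartAt (𝓡 m) x)
      (torusExp p.1 • (extChartAt (𝓡 m) x).symm p.2) :=
    contMDiffAt_extChartAt' (by simpa using hp.2)
  have h2 : ContMDiffAt 𝓘(ℝ, EuclideanSpace ℝ (Fin m)) (𝓡 m) ∞ (extChartAt (𝓡 m) x).symm p.2 :=
    (contMDiffOn_extChartAt_symm x).contMDiffAt ((isOpen_extChartAt_target x).mem_nhds hp.1)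
  have h3 : ContMDiffAt 𝓘(ℝ, (Fin n → ℝ) × EuclideanSpace ℝ (Fin m))
      (𝓘(ℝ, Fin n → ℝ).prod (𝓡 m)) ∞
      (fun q : (Fin n → ℝ) × EuclideanSpace ℝ (Fin m) => (q.1, (extChartAt (𝓡 m) x).symm q.2)) p :=
    ContMDiffAt.prodMk contDiff_fst.contMDiff.contMDiffAt
      (ContMDiffAt.comp p h2 contDiff_snd.contMDiff.contMDiffAt)
  exact h1.comp p ((hsm _).comp p h3)

theorem hasFDerivAt_chartAction {x : M} {p : (Fin n → ℝ) × EuclideanSpace ℝ (Fin m)}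
    (hp : p ∈ chartDomain n m x) :
    HasFDerivAt (chartAction n m x) (fderiv ℝ (chartAction n m x) p) p :=
  ((contDiffAt_chartAction hsm hp).differentiableAt (by simp)).hasFDerivAt

theorem contDiffAt_fderiv_chartAction {x : M} {p : (Fin n → ℝ) × EuclideanSpace ℝ (Fin m)}
    (hp : p ∈ chartDomain n m x) : ContDiffAt ℝ ∞ (fderiv ℝ (chartAction n m x)) p :=
  (contDiffAt_chartAction hsm hp).fderiv_right (by simp)

/-- The fundamental vector field in a chart. -/
theorem fderiv_chartAction_inl {x y : M} (hy : y ∈ (extChartAt (𝓡 m) x).source) (ς : Fin n → ℝ) :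
    fderiv ℝ (chartAction n m x) (0, extChartAt (𝓡 m) x y) (ς, 0)
      = mfderiv (𝓡 m) 𝓘(ℝ, EuclideanSpace ℝ (Fin m)) (extChartAt (𝓡 m) x)
        (torusExp ((0 : ℝ) • ς) • y) (fundField m M ς y) := by
  have h0 : torusExp ((0 : ℝ) • ς) • y = y := by rw [zero_smul, torusExp_zero, one_smul]
  have h1 : HasMFDerivAt 𝓘(ℝ, ℝ) (𝓡 m) (fun s : ℝ => torusExp (s • ς) • y) 0
      (mfderiv 𝓘(ℝ, ℝ) (𝓡 m) (fun s : ℝ => torusExp (s • ς) • y) 0) :=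
    ((contMDiff_orbit hsm ς y).mdifferentiable (by simp) 0).hasMFDerivAt
  have h2 : HasMFDerivAt (𝓡 m) 𝓘(ℝ, EuclideanSpace ℝ (Fin m)) (extChartAt (𝓡 m) x)
      (torusExp ((0 : ℝ) • ς) • y) (mfderiv (𝓡 m) 𝓘(ℝ, EuclideanSpace ℝ (Fin m))
        (extChartAt (𝓡 m) x) (torusExp ((0 : ℝ) • ς) • y)) :=
    (mdifferentiableAt_extChartAt (by rw [h0]; simpa using hy)).hasMFDerivAt
  have h3 := (h2.comp (0 : ℝ) h1).hasFDerivAt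
  have h4 : HasFDerivAt (fun s : ℝ => chartAction n m x (s • ς, extChartAt (𝓡 m) x y))
      ((fderiv ℝ (chartAction n m x) (0, extChartAt (𝓡 m) x y)).comp
        (((ContinuousLinearMap.id ℝ ℝ).smulRight ς).prod 0)) 0 := by
    refine HasFDerivAt.comp (0 : ℝ) (g := chartAction n m x)
      (f := fun s : ℝ => (s • ς, extChartAt (𝓡 m) x y)) ?_ ?_
    · rw [zero_smul]; exact hasFDerivAt_chartAction hsm (mem_chartDomain_zero hy)
    · exact ((hasFDerivAt_id (0 : ℝ)).smul_const ς).prodMk (hasFDerivAt_const _ _)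
  have h5 : (fun s : ℝ => chartAction n m x (s • ς, extChartAt (𝓡 m) x y))
      = extChartAt (𝓡 m) x ∘ fun s : ℝ => torusExp (s • ς) • y := by
    funext s; exact chartAction_apply hy
  rw [h5] at h4
  have h6 := DFunLike.congr_fun (h4.unique h3) (1 : ℝ)
  simpa using! h6

/-- The tangent space at `x` is identified with the model space by the chart centred at `x`, so this
chart has identity derivative there. -/
theorem fderiv_chartAction_inl_self (x : M) (ς : Fin n → ℝ) :
    fderiv ℝ (chartAction n m x) (0, extChartAt (𝓡 m) x x) (ς, 0) = fundField m M ς x := by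
  rw [fderiv_chartAction_inl hsm (mem_extChartAt_source x)]
  have h0 : torusExp ((0 : ℝ) • ς) • x = x := by rw [zero_smul, torusExp_zero, one_smul]
  -- The base point `torusExp (0 • ς) • x` is not syntactically `x`; it is generalized in order to
  -- be substituted.
  have key : ∀ z, z = x → ∀ v : EuclideanSpace ℝ (Fin m),
      (mfderiv (𝓡 m) 𝓘(ℝ, EuclideanSpace ℝ (Fin m)) (extChartAt (𝓡 m) x) z :
        EuclideanSpace ℝ (Fin m) →L[ℝ] EuclideanSpace ℝ (Fin m)) v = v := by
    rintro z rfl v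
    rw [mfderiv_extChartAt_self]; rfl
  exact key _ h0 _

/-- The differential of the action of a stabilizing element in a chart. -/
theorem actionDeriv_eq {x : M} {ς : Fin n → ℝ} (hς : torusExp ς • x = x)
    (v : EuclideanSpace ℝ (Fin m)) :
    actionDeriv m (torusExp ς) x v
      = fderiv ℝ (chartAction n m x) (ς, extChartAt (𝓡 m) x x) (0, v) := by
  have hd : (ς, extChartAt (𝓡 m) x x) ∈ chartDomain n m x :=
    mem_chartDomain (mem_extChartAt_source x) (by rw [hς]; exact mem_extChartAt_source x)
  have h1 := ((contMDiff_smul hsm (torusExp ς)).mdifferentiable (by simp) x)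
  have h2 : writtenInExtChartAt (𝓡 m) (𝓡 m) x (fun y : M => torusExp ς • y)
      = fun y => chartAction n m x (ς, y) := by
    funext y
    simp only [writtenInExtChartAt, Function.comp_apply, chartAction, hς]
  have h3 : actionDeriv m (torusExp ς) x
      = fderiv ℝ (fun y => chartAction n m x (ς, y)) (extChartAt (𝓡 m) x x) := by
    refine h1.mfderiv.trans ?_
    have h5 := congrArg (fun f => fderivWithin ℝ f (Set.range (𝓡 m)) (extChartAt (𝓡 m) x x)) h2
    refine h5.trans ?_
    simp
  have h4 : HasFDerivAt (fun y => chartAction n m x (ς, y))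
      ((fderiv ℝ (chartAction n m x) (ς, extChartAt (𝓡 m) x x)).comp
        (ContinuousLinearMap.inr ℝ _ _)) (extChartAt (𝓡 m) x x) :=
    (hasFDerivAt_chartAction hsm hd).comp _ (hasFDerivAt_prodMk_right ς (extChartAt (𝓡 m) x x))
  rw [h3, h4.fderiv]
  rfl

end ChartAction

/-! ### Faithfulness of the isotropy representation -/


/-- A bounded sequence whose increments are all close to the first one has no increments. -/
theorem eq_of_bounded_of_increments_near {V : Type*} [NormedAddCommGroup V] [NormedSpace ℝ V]
    {y : ℕ → V} {p : V} {r : ℝ} (hb : ∀ k, ‖y k - p‖ ≤ r)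
    (h : ∀ k, ‖(y (k + 1) - y k) - (y 1 - y 0)‖ ≤ 1 / 2 * ‖y 1 - y 0‖) : y 1 = y 0 := by
  set v := y 1 - y 0 with hv
  have h1 : ∀ N : ℕ, ‖y N - y 0 - (N : ℝ) • v‖ ≤ N * (1 / 2 * ‖v‖) := by
    intro N
    induction N with
    | zero => simp
    | succ N ih =>
      have e : y (N + 1) - y 0 - ((N + 1 : ℕ) : ℝ) • v
          = (y N - y 0 - (N : ℝ) • v) + ((y (N + 1) - y N) - v) := by
        push_cast
        module
      rw [e]
      refine (norm_add_le _ _).trans ?_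
      push_cast
      linarith [h N]
  have h2 : ∀ N : ℕ, (N : ℝ) * (1 / 2 * ‖v‖) ≤ 2 * r := by
    intro N
    have e : (N : ℝ) • v = (y N - p) - (y 0 - p) - (y N - y 0 - (N : ℝ) • v) := by abel
    have h3 : (N : ℝ) * ‖v‖ = ‖(N : ℝ) • v‖ := by
      rw [norm_smul, Real.norm_natCast]
    have h4 : ‖(N : ℝ) • v‖ ≤ ‖y N - p‖ + ‖y 0 - p‖ + ‖y N - y 0 - (N : ℝ) • v‖ := by
      conv_lhs => rw [e]
      exact (norm_sub_le _ _).trans (by gcongr; exact norm_sub_le _ _)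
    linarith [h1 N, hb N, hb 0]
  by_contra hne
  have hpos : 0 < 1 / 2 * ‖v‖ := by
    have := norm_pos_iff.mpr (sub_ne_zero.mpr hne)
    linarith
  obtain ⟨N, hN⟩ := Archimedean.arch (2 * r + 1) hpos
  have := h2 N
  rw [nsmul_eq_mul] at hN
  linarith

section Isotropy

variable {n m : ℕ} {M : Type*} [TopologicalSpace M]
  [ChartedSpace (EuclideanSpace ℝ (Fin m)) M] [IsManifold (𝓡 m) ∞ M] [MulAction (Torus n) M]

variable (n m) in
/-- The derivative of the action at `(ς, y)` along `M`, in the chart centred at `x`. -/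
noncomputable def spaceDeriv (x : M) (p : (Fin n → ℝ) × EuclideanSpace ℝ (Fin m)) :
    EuclideanSpace ℝ (Fin m) →L[ℝ] EuclideanSpace ℝ (Fin m) :=
  (fderiv ℝ (chartAction n m x) p).comp (ContinuousLinearMap.inr ℝ _ _)

theorem mem_chartDomain_self {x : M} {ς : Fin n → ℝ} (hς : torusExp ς • x = x) :
    (ς, extChartAt (𝓡 m) x x) ∈ chartDomain n m x :=
  mem_chartDomain (mem_extChartAt_source x) (by rw [hς]; exact mem_extChartAt_source x)

theorem chartAction_self {x : M} {ς : Fin n → ℝ} (hς : torusExp ς • x = x) :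
    chartAction n m x (ς, extChartAt (𝓡 m) x x) = extChartAt (𝓡 m) x x := by
  rw [chartAction_apply (mem_extChartAt_source x), hς]

variable (hsm : IsSmoothAction n m M)
include hsm

theorem hasFDerivAt_spaceDeriv {x : M} {p : (Fin n → ℝ) × EuclideanSpace ℝ (Fin m)}
    (hp : p ∈ chartDomain n m x) :
    HasFDerivAt (fun y => chartAction n m x (p.1, y)) (spaceDeriv n m x p) p.2 :=
  HasFDerivAt.comp p.2 (g := chartAction n m x) (f := fun y => (p.1, y))
    (hasFDerivAt_chartAction hsm hp) (hasFDerivAt_prodMk_right p.1 p.2)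

theorem continuousAt_spaceDeriv {x : M} {p : (Fin n → ℝ) × EuclideanSpace ℝ (Fin m)}
    (hp : p ∈ chartDomain n m x) : ContinuousAt (spaceDeriv n m x) p :=
  (contDiffAt_fderiv_chartAction hsm hp).continuousAt.clm_comp continuousAt_const

/-- Lets an exponent be replaced by a representative in the ball of radius `π`, where compactness is
available. -/
theorem spaceDeriv_congr {x : M} {ς ζ : Fin n → ℝ} (h : torusExp ς = torusExp ζ)
    (hς : torusExp ς • x = x) :
    spaceDeriv n m x (ς, extChartAt (𝓡 m) x x) = spaceDeriv n m x (ζ, extChartAt (𝓡 m) x x) := by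
  have h1 := hasFDerivAt_spaceDeriv hsm (mem_chartDomain_self (m := m) hς)
  have h2 := hasFDerivAt_spaceDeriv hsm (mem_chartDomain_self (m := m) (h ▸ hς))
  simp only [chartAction, h] at h1 h2
  exact h1.unique h2

theorem spaceDeriv_add {x : M} {ς ζ : Fin n → ℝ} (hς : torusExp ς • x = x)
    (hζ : torusExp ζ • x = x) :
    spaceDeriv n m x (ς + ζ, extChartAt (𝓡 m) x x)
      = (spaceDeriv n m x (ς, extChartAt (𝓡 m) x x)).comp
          (spaceDeriv n m x (ζ, extChartAt (𝓡 m) x x)) := by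
  have hsum : torusExp (ς + ζ) • x = x := by rw [torusExp_add, mul_smul, hζ, hς]
  have h1 := hasFDerivAt_spaceDeriv hsm (mem_chartDomain_self (m := m) hς)
  have h2 := hasFDerivAt_spaceDeriv hsm (mem_chartDomain_self (m := m) hζ)
  have h3 := hasFDerivAt_spaceDeriv hsm (mem_chartDomain_self (m := m) hsum)
  have h4 := HasFDerivAt.comp (extChartAt (𝓡 m) x x)
    (g := fun y => chartAction n m x (ς, y)) (f := fun y => chartAction n m x (ζ, y))
    (by rw [chartAction_self hζ]; exact h1) h2
  refine h3.unique (h4.congr_of_eventuallyEq ?_)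
  have h5 : ∀ᶠ y in 𝓝 (extChartAt (𝓡 m) x x), (ζ, y) ∈ chartDomain n m x :=
    (Continuous.continuousAt (by fun_prop : Continuous fun y => (ζ, y))).eventually_mem
      ((isOpen_chartDomain hsm x).mem_nhds (mem_chartDomain_self hζ))
  filter_upwards [h5] with y hy
  simp only [Function.comp_apply, chartAction, (extChartAt (𝓡 m) x).left_inv hy.2, torusExp_add,
    mul_smul]

theorem spaceDeriv_zero (x : M) : spaceDeriv n m x (0, extChartAt (𝓡 m) x x)
    = ContinuousLinearMap.id ℝ (EuclideanSpace ℝ (Fin m)) := by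
  have h0 : torusExp (0 : Fin n → ℝ) • x = x := by rw [torusExp_zero, one_smul]
  refine (hasFDerivAt_spaceDeriv hsm (mem_chartDomain_self (m := m) h0)).unique
    ((hasFDerivAt_id _).congr_of_eventuallyEq ?_)
  filter_upwards [extChartAt_target_mem_nhds (I := 𝓡 m) x] with y hy
  simp only [chartAction, torusExp_zero, one_smul, (extChartAt (𝓡 m) x).right_inv hy, id]

variable [T2Space M]

/-- A stabilizing element with trivial differential acts trivially near the fixed point. -/
theorem eventually_smul_eq {x : M} {ς : Fin n → ℝ} (hς : torusExp ς • x = x)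
    (hd : spaceDeriv n m x (ς, extChartAt (𝓡 m) x x) = ContinuousLinearMap.id ℝ _) :
    ∀ᶠ z in 𝓝 x, torusExp ς • z = z := by
  set φ := extChartAt (𝓡 m) x with hφ
  -- All powers of `torusExp ς` have exponents in this compact set, which makes the estimates below
  -- uniform over the powers.
  let C : Set (Fin n → ℝ) := Metric.closedBall 0 Real.pi ∩
    {ζ | torusExp ζ • x = x ∧ spaceDeriv n m x (ζ, φ x) = ContinuousLinearMap.id ℝ _}
  have hC : IsCompact C := by
    refine (isCompact_closedBall _ _).inter_right ?_
    have hcl : IsClosed {ζ : Fin n → ℝ | torusExp ζ • x = x} :=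
      isClosed_eq ((continuous_torusExp_smul hsm).comp (by fun_prop : Continuous fun ζ => (ζ, x)))
        continuous_const
    refine ContinuousOn.preimage_isClosed_of_isClosed
      (f := fun ζ => spaceDeriv n m x (ζ, φ x)) (t := {ContinuousLinearMap.id ℝ _}) ?_ hcl
      isClosed_singleton
    intro ζ hζ
    refine ContinuousAt.continuousWithinAt ?_
    exact (continuousAt_spaceDeriv hsm (mem_chartDomain_self hζ)).comp
      (f := fun ζ => (ζ, φ x)) (by fun_prop)
  have hpow : ∀ k : ℕ, ∃ ζ ∈ C, torusExp ζ = torusExp ς ^ k := by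
    intro k
    have h1 : torusExp ((k : ℝ) • ς) = torusExp ς ^ k ∧ torusExp ς ^ k • x = x ∧
        spaceDeriv n m x ((k : ℝ) • ς, φ x) = ContinuousLinearMap.id ℝ _ := by
      induction k with
      | zero => exact ⟨by simp [torusExp_zero], by simp, by
          rw [Nat.cast_zero, zero_smul]; exact spaceDeriv_zero hsm x⟩
      | succ k ih =>
        obtain ⟨i1, i2, i3⟩ := ih
        have e : ((k + 1 : ℕ) : ℝ) • ς = (k : ℝ) • ς + ς := by push_cast; module
        refine ⟨by rw [e, torusExp_add, i1, pow_succ], by rw [pow_succ, mul_smul, hς, i2], ?_⟩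
        rw [e, spaceDeriv_add hsm (by rw [i1, i2]) hς, i3, hd]
        rfl
    obtain ⟨ζ, hζ, e⟩ := exists_torusExp_eq (torusExp ς ^ k)
    have hx : torusExp ζ • x = x := by rw [e]; exact h1.2.1
    refine ⟨ζ, ⟨hζ, hx, ?_⟩, e⟩
    rw [spaceDeriv_congr hsm (e.trans h1.1.symm) hx]
    exact h1.2.2
  have hnear : ∀ᶠ y in 𝓝 (φ x), ∀ ζ ∈ C, (ζ, y) ∈ chartDomain n m x ∧
      ‖spaceDeriv n m x (ζ, y) - ContinuousLinearMap.id ℝ _‖ ≤ 1 / 2 := by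
    refine hC.eventually_forall_of_forall_eventually fun ζ hζ => ?_
    have hmem : (ζ, φ x) ∈ chartDomain n m x := mem_chartDomain_self hζ.2.1
    have hc : ContinuousAt (fun q => ‖spaceDeriv n m x q - ContinuousLinearMap.id ℝ _‖) (ζ, φ x) :=
      ((continuousAt_spaceDeriv hsm hmem).sub continuousAt_const).norm
    have h2 : ∀ᶠ q in 𝓝 (ζ, φ x),
        ‖spaceDeriv n m x q - ContinuousLinearMap.id ℝ _‖ < 1 / 2 := by
      refine hc.eventually_lt continuousAt_const ?_
      rw [hζ.2.2]; simp
    have h3 : ∀ᶠ q in 𝓝 (ζ, φ x), q ∈ chartDomain n m x ∧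
        ‖spaceDeriv n m x q - ContinuousLinearMap.id ℝ _‖ ≤ 1 / 2 := by
      filter_upwards [h2, (isOpen_chartDomain hsm x).mem_nhds hmem] with q h h' using ⟨h', h.le⟩
    exact (continuous_swap.tendsto (φ x, ζ)).eventually h3
  obtain ⟨r, hr, hball⟩ := Metric.eventually_nhds_iff_ball.mp hnear
  -- Applied to consecutive orbit points `y 1` and `y 0`, this bounds the change of the increment `y
  -- 1 - y 0` under any power by half its norm. The orbit stays bounded, so the increment must
  -- vanish.
  have hlip : ∀ ζ ∈ C, ∀ y ∈ Metric.ball (φ x) r, ∀ z ∈ Metric.ball (φ x) r,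
      ‖(chartAction n m x (ζ, y) - y) - (chartAction n m x (ζ, z) - z)‖ ≤ 1 / 2 * ‖y - z‖ := by
    intro ζ hζ y hy z hz
    refine (convex_ball (φ x) r).norm_image_sub_le_of_norm_hasFDerivWithin_le
      (f := fun y => chartAction n m x (ζ, y) - y)
      (f' := fun y => spaceDeriv n m x (ζ, y) - ContinuousLinearMap.id ℝ _)
      (fun w hw => ?_) (fun w hw => (hball w hw ζ hζ).2) hz hy
    exact ((hasFDerivAt_spaceDeriv hsm (hball w hw ζ hζ).1).sub (hasFDerivAt_id w)).hasFDerivWithinAt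
  have hmain : ∀ᶠ z in 𝓝 x, z ∈ φ.source ∧ φ z ∈ Metric.ball (φ x) (r / 2) :=
    Filter.Eventually.and (extChartAt_source_mem_nhds (I := 𝓡 m) x)
      ((continuousAt_extChartAt x).eventually_mem (Metric.ball_mem_nhds _ (by linarith)))
  filter_upwards [hmain] with z hz
  obtain ⟨hzs, hzb⟩ := hz
  have hzr : φ z ∈ Metric.ball (φ x) r := Metric.ball_subset_ball (by linarith) hzb
  choose ζ hζC hζ using hpow
  have hs : ∀ k : ℕ, torusExp ς ^ k • z ∈ φ.source := by
    intro k
    have := (hball _ hzr _ (hζC k)).1.2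
    rwa [φ.left_inv hzs, hζ] at this
  have hval : ∀ k l : ℕ, chartAction n m x (ζ k, φ (torusExp ς ^ l • z))
      = φ (torusExp ς ^ (k + l) • z) := by
    intro k l
    rw [chartAction_apply (hs l), hζ, smul_smul, ← pow_add]
  have hbd : ∀ k : ℕ, φ (torusExp ς ^ k • z) ∈ Metric.ball (φ x) r := by
    intro k
    have h1 := hlip _ (hζC k) _ hzr _ (Metric.mem_ball_self hr)
    have h2 := hval k 0
    simp only [pow_zero, one_smul, add_zero] at h2
    rw [h2, chartAction_self (hζC k).2.1, sub_self, sub_zero] at h1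
    rw [mem_ball_iff_norm] at hzb ⊢
    have e : φ (torusExp ς ^ k • z) - φ x
        = (φ (torusExp ς ^ k • z) - φ z) + (φ z - φ x) := by abel
    rw [e]
    refine (norm_add_le _ _).trans_lt ?_
    linarith
  have hfix := eq_of_bounded_of_increments_near (y := fun k => φ (torusExp ς ^ k • z)) (p := φ x)
    (r := r) (fun k => (mem_ball_iff_norm.mp (hbd k)).le) (fun k => by
      have h1 := hlip _ (hζC k) _ (hbd 1) _ (hbd 0)
      rw [hval, hval, add_zero] at h1
      refine le_trans (le_of_eq ?_) h1
      congr 1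
      abel)
  have := φ.injOn (hs 1) (hs 0) hfix
  simpa using this

/-- The isotropy representations of an effective torus action on a connected manifold are
faithful. -/
theorem torusExp_eq_one_of_spaceDeriv [PreconnectedSpace M]
    (heff : ∀ t : Torus n, (∀ x : M, t • x = x) → t = 1) {x : M} {ς : Fin n → ℝ}
    (hς : torusExp ς • x = x)
    (hd : spaceDeriv n m x (ς, extChartAt (𝓡 m) x x) = ContinuousLinearMap.id ℝ _) :
    torusExp ς = 1 := by
  set W : Set M := {z | ∀ᶠ w in 𝓝 z, torusExp ς • w = w} with hW
  have hopen : IsOpen W := isOpen_setOfPred_eventually_nhds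
  have hfix : IsClosed {z : M | torusExp ς • z = z} :=
    isClosed_eq (contMDiff_smul hsm (torusExp ς)).continuous continuous_id
  have hsub : W ⊆ {z : M | torusExp ς • z = z} := fun z hz => hz.self_of_nhds
  have hclosed : IsClosed W := by
    refine isClosed_of_closure_subset fun z hz => ?_
    have hz1 : torusExp ς • z = z := closure_minimal hsub hfix hz
    refine eventually_smul_eq hsm hz1 ?_
    -- At points of `W` the element fixes a neighbourhood, so its derivative there is the identity;
    -- continuity carries this to the limit `z`.
    by_contra hne
    have hc : ContinuousAt (fun w => spaceDeriv n m z (ς, extChartAt (𝓡 m) z w)) z :=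
      ContinuousAt.comp (g := spaceDeriv n m z) (f := fun w => (ς, extChartAt (𝓡 m) z w))
        (continuousAt_spaceDeriv hsm (mem_chartDomain_self hz1))
        (continuousAt_const.prodMk (continuousAt_extChartAt z))
    have h1 := hc.eventually_ne hne
    obtain ⟨w, hwW, hw1, hw2⟩ := ((mem_closure_iff_frequently.mp hz).and_eventually
      (h1.and (extChartAt_source_mem_nhds (I := 𝓡 m) z))).exists
    refine hw1 ?_
    have hdom : (ς, extChartAt (𝓡 m) z w) ∈ chartDomain n m z :=
      mem_chartDomain hw2 (by rw [hsub hwW]; exact hw2)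
    refine (hasFDerivAt_spaceDeriv hsm hdom).unique ((hasFDerivAt_id _).congr_of_eventuallyEq ?_)
    have h3 : ContinuousAt (extChartAt (𝓡 m) z).symm (extChartAt (𝓡 m) z w) :=
      continuousAt_extChartAt_symm' hw2
    have h4 : ∀ᶠ y in 𝓝 (extChartAt (𝓡 m) z w),
        torusExp ς • (extChartAt (𝓡 m) z).symm y = (extChartAt (𝓡 m) z).symm y := by
      refine h3.eventually (p := fun u => torusExp ς • u = u) ?_
      rw [(extChartAt (𝓡 m) z).left_inv hw2]
      exact hwW
    filter_upwards [h4, extChartAt_target_mem_nhds' (I := 𝓡 m)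
      ((extChartAt (𝓡 m) z).map_source hw2)] with y hy hyt
    simp only [chartAction, hy, (extChartAt (𝓡 m) z).right_inv hyt, id]
  have huniv : W = Set.univ :=
    IsClopen.eq_univ ⟨hclosed, hopen⟩ ⟨x, eventually_smul_eq hsm hς hd⟩
  exact heff _ fun z => hsub (huniv ▸ Set.mem_univ z)

end Isotropy

/-! ### One-parameter families of linear maps -/

section Families

variable {T V : Type*} [NormedAddCommGroup T] [NormedSpace ℝ T] [FiniteDimensional ℝ T]
  [NormedAddCommGroup V] [NormedSpace ℝ V]

/-- Compose with a left inverse of the limit: the result tends to the identity, and invertible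
operators form an open set. -/
theorem eventually_injective_of_tendsto {ι : Type*} {l : Filter ι} {A : ι → T →L[ℝ] V}
    {A₀ : T →L[ℝ] V} [FiniteDimensional ℝ V] (hA : Tendsto A l (𝓝 A₀))
    (h₀ : Function.Injective A₀) : ∀ᶠ i in l, Function.Injective (A i) := by
  obtain ⟨B, hB⟩ := LinearMap.exists_leftInverse_of_injective (A₀ : T →ₗ[ℝ] V)
    (LinearMap.ker_eq_bot.mpr h₀)
  let B' : V →L[ℝ] T := LinearMap.toContinuousLinearMap B
  have h1 : Tendsto (fun i => B'.comp (A i)) l (𝓝 (1 : T →L[ℝ] T)) := by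
    have h2 : B'.comp A₀ = 1 := by
      ext v
      exact LinearMap.congr_fun hB v
    rw [← h2]
    exact ((ContinuousLinearMap.postcomp T B').continuous.tendsto A₀).comp hA
  have h3 := h1.eventually (Units.isOpen.mem_nhds isUnit_one)
  filter_upwards [h3] with i hi
  obtain ⟨u, hu⟩ := hi
  refine (injective_iff_map_eq_zero (A i)).mpr fun v hv => ?_
  have h4 : (u : T →L[ℝ] T) v = 0 := by rw [hu]; simp [hv]
  have h5 : (((u⁻¹ : (T →L[ℝ] T)ˣ) : T →L[ℝ] T) * (u : T →L[ℝ] T)) v = 0 :=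
    (congrArg ((u⁻¹ : (T →L[ℝ] T)ˣ) : T →L[ℝ] T) h4).trans (map_zero _)
  rwa [Units.inv_mul] at h5

/-- If the derivative of a family of linear maps is injective from the kernel to the cokernel, then
the family becomes injective. -/
theorem eventually_injective_of_hasDerivAt [FiniteDimensional ℝ V] {ψ : ℝ → T →L[ℝ] V}
    {ψ' : T →L[ℝ] V} (hψ : HasDerivAt ψ ψ' 0)
    (h : ∀ u r, ψ 0 u = 0 → ψ' u = ψ 0 r → u = 0) :
    ∀ᶠ ε in 𝓝[≠] (0 : ℝ), Function.Injective (ψ ε) := by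
  set K := LinearMap.ker (ψ 0 : T →ₗ[ℝ] V) with hK
  obtain ⟨K', hKK'⟩ := K.exists_isCompl
  let p : T →L[ℝ] T := LinearMap.toContinuousLinearMap (K.projection K' hKK')
  have hpmem : ∀ u, ψ 0 (p u) = 0 := fun u => by
    have : K.projection K' hKK' u ∈ K := Submodule.projection_apply_mem hKK' u
    exact this
  have hpid : ∀ u, ψ 0 u = 0 → p u = u := fun u hu =>
    Submodule.projection_apply_left hKK' (⟨u, hu⟩ : K)
  -- On the kernel of `ψ 0` the map `ψ ε` is divided by `ε`, on a complement it is kept. The limit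
  -- is `ψ'` on the kernel plus `ψ 0` on the complement, injective by hypothesis; for `ε ≠ 0` the
  -- rescaling does not affect injectivity.
  let A : ℝ → T →L[ℝ] V := fun ε =>
    (ψ ε).comp (ContinuousLinearMap.id ℝ T - p) + (ε⁻¹ • (ψ ε - ψ 0)).comp p
  let A₀ : T →L[ℝ] V := (ψ 0).comp (ContinuousLinearMap.id ℝ T - p) + ψ'.comp p
  have hA : Tendsto A (𝓝[≠] 0) (𝓝 A₀) := by
    have h1 : Tendsto ψ (𝓝[≠] 0) (𝓝 (ψ 0)) := hψ.continuousAt.tendsto.mono_left nhdsWithin_le_nhds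
    have h2 : Tendsto (fun ε : ℝ => ε⁻¹ • (ψ ε - ψ 0)) (𝓝[≠] 0) (𝓝 ψ') := by
      simpa using hψ.tendsto_slope_zero
    exact (((ContinuousLinearMap.precomp V _).continuous.tendsto (ψ 0)).comp h1).add
      (((ContinuousLinearMap.precomp V p).continuous.tendsto ψ').comp h2)
  have hA₀ : Function.Injective A₀ := by
    refine (injective_iff_map_eq_zero A₀).mpr fun u hu => ?_
    have h1 : ψ 0 (u - p u) + ψ' (p u) = 0 := hu
    have h2 : p u = 0 := h (p u) (-(u - p u)) (hpmem u) (by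
      rw [map_neg]; exact eq_neg_of_add_eq_zero_right h1)
    rw [h2, sub_zero, map_zero, add_zero] at h1
    rw [← hpid u h1, h2]
  filter_upwards [eventually_injective_of_tendsto hA hA₀, self_mem_nhdsWithin] with ε hε hne
  have hne' : ε ≠ 0 := hne
  refine (injective_iff_map_eq_zero (ψ ε)).mpr fun u hu => ?_
  have hpp : p (p u) = p u := hpid _ (hpmem u)
  have h1 : A ε ((u - p u) + ε • p u) = 0 := by
    have e : p ((u - p u) + ε • p u) = ε • p u := by simp [hpp]
    have : A ε ((u - p u) + ε • p u) = ψ ε ((u - p u) + ε • p u - p ((u - p u) + ε • p u))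
      + ε⁻¹ • (ψ ε (p ((u - p u) + ε • p u)) - ψ 0 (p ((u - p u) + ε • p u))) := rfl
    rw [this, e, add_sub_cancel_right, map_smul, map_smul, hpmem, smul_zero, sub_zero, smul_smul,
      inv_mul_cancel₀ hne', one_smul, ← map_add, sub_add_cancel, hu]
  have h2 := (injective_iff_map_eq_zero (A ε)).mp hε _ h1
  have h3 := congrArg p h2
  simp only [map_add, map_sub, map_smul, hpp, sub_self, zero_add, map_zero] at h3
  have h4 : p u = 0 := (smul_eq_zero.mp h3).resolve_left hne'
  simpa [h4] using h2

variable {A : ℝ → V →L[ℝ] V} {N : V →L[ℝ] V}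

theorem HasDerivAt.apply_comm_of_comm (hA : HasDerivAt A N 0) {B : V →L[ℝ] V}
    (h : ∀ s v, A s (B v) = B (A s v)) (v : V) : N (B v) = B (N v) := by
  have h1 : HasDerivAt (fun s => A s (B v)) (N (B v)) 0 := by
    simpa using hA.clm_apply (hasDerivAt_const (0 : ℝ) (B v))
  have h2 : HasDerivAt (fun s => B (A s v)) (B (N v)) 0 :=
    B.hasFDerivAt.comp_hasDerivAt (0 : ℝ) (by
      simpa using hA.clm_apply (hasDerivAt_const (0 : ℝ) v))
  simp only [h] at h1
  exact h1.unique h2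

theorem HasDerivAt.skew_of_isometry [FiniteDimensional ℝ V] (hA : HasDerivAt A N 0)
    (h0 : A 0 = ContinuousLinearMap.id ℝ V) {g : V →ₗ[ℝ] V →ₗ[ℝ] ℝ}
    (h : ∀ s u v, g (A s u) (A s v) = g u v) (u v : V) : g (N u) v = -g u (N v) := by
  let g' : V →L[ℝ] V →L[ℝ] ℝ := LinearMap.toContinuousLinearMap
    ((LinearMap.toContinuousLinearMap : (V →ₗ[ℝ] ℝ) ≃ₗ[ℝ] (V →L[ℝ] ℝ)).toLinearMap ∘ₗ g)
  have hg : ∀ a c, g' a c = g a c := fun _ _ => rfl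
  have hu : ∀ w, HasDerivAt (fun s => A s w) (N w) 0 := fun w => by
    simpa using hA.clm_apply (hasDerivAt_const (0 : ℝ) w)
  have h1 := (g'.hasFDerivAt.comp_hasDerivAt (0 : ℝ) (hu u)).clm_apply (hu v)
  have h2 : (fun s => g' (A s u) (A s v)) = fun _ => g u v := by
    funext s; rw [hg, h]
  simp only [Function.comp_apply] at h1
  rw [h2] at h1
  have h3 := h1.unique (hasDerivAt_const (0 : ℝ) (g u v))
  simp only [h0, ContinuousLinearMap.id_apply, hg] at h3
  linarith

end Families

/-! ### The linearized torus action at a point -/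

section Linearization

variable {n m : ℕ} {M : Type*} [TopologicalSpace M]
  [ChartedSpace (EuclideanSpace ℝ (Fin m)) M] [IsManifold (𝓡 m) ∞ M] [MulAction (Torus n) M]

variable (n m) in
/-- The infinitesimal action at `x`. -/
noncomputable def infAction (x : M) : (Fin n → ℝ) →ₗ[ℝ] EuclideanSpace ℝ (Fin m) :=
  (fderiv ℝ (chartAction n m x) (0, extChartAt (𝓡 m) x x)).toLinearMap ∘ₗ LinearMap.inl ℝ _ _

variable (n m) in
/-- The linearization at `x` of the fundamental vector fields, in the chart centred at `x`. -/
noncomputable def linAction (x : M) : (Fin n → ℝ) →L[ℝ]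
    EuclideanSpace ℝ (Fin m) →L[ℝ] EuclideanSpace ℝ (Fin m) :=
  (ContinuousLinearMap.precomp (EuclideanSpace ℝ (Fin m))
    (ContinuousLinearMap.inr ℝ (Fin n → ℝ) (EuclideanSpace ℝ (Fin m)))).comp
    ((fderiv ℝ (fderiv ℝ (chartAction n m x)) (0, extChartAt (𝓡 m) x x)).comp
      (ContinuousLinearMap.inl ℝ _ _))

variable (hsm : IsSmoothAction n m M)
include hsm

theorem infAction_apply (x : M) (ς : Fin n → ℝ) : infAction n m x ς = fundField m M ς x :=
  fderiv_chartAction_inl_self hsm x ς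

/-- Symmetry of second derivatives: differentiating the isotropy representation in time agrees with
differentiating the fundamental fields in space. -/
theorem linAction_apply_swap (x : M) (ς : Fin n → ℝ) (v : EuclideanSpace ℝ (Fin m)) :
    linAction n m x ς v
      = fderiv ℝ (fderiv ℝ (chartAction n m x)) (0, extChartAt (𝓡 m) x x) (0, v) (ς, 0) :=
  ((contDiffAt_chartAction hsm
    (mem_chartDomain_zero (mem_extChartAt_source x))).isSymmSndFDerivAt (by
      rw [minSmoothness_of_isRCLikeNormedField]
      exact WithTop.coe_le_coe.mpr le_top)) _ _

theorem hasDerivAt_spaceDeriv (x : M) (ς : Fin n → ℝ) :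
    HasDerivAt (fun s : ℝ => spaceDeriv n m x (s • ς, extChartAt (𝓡 m) x x))
      (linAction n m x ς) 0 := by
  have h1 : HasFDerivAt (fderiv ℝ (chartAction n m x))
      (fderiv ℝ (fderiv ℝ (chartAction n m x)) (0, extChartAt (𝓡 m) x x))
      ((0 : ℝ) • ς, extChartAt (𝓡 m) x x) := by
    rw [zero_smul]
    exact ((contDiffAt_fderiv_chartAction hsm
      (mem_chartDomain_zero (mem_extChartAt_source x))).differentiableAt (by simp)).hasFDerivAt
  have h2 : HasDerivAt (fun s : ℝ => (s • ς, extChartAt (𝓡 m) x x)) (ς, 0) 0 := by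
    simpa using ((hasDerivAt_id (0 : ℝ)).smul_const ς).prodMk
      (hasDerivAt_const (0 : ℝ) (extChartAt (𝓡 m) x x))
  have h3 := h1.comp_hasDerivAt (0 : ℝ) h2
  exact (ContinuousLinearMap.precomp (EuclideanSpace ℝ (Fin m))
    (ContinuousLinearMap.inr ℝ (Fin n → ℝ) (EuclideanSpace ℝ (Fin m)))).hasFDerivAt.comp_hasDerivAt (0 : ℝ) h3

theorem hasDerivAt_chartAction_add {x : M} {ς : Fin n → ℝ} (ζ : Fin n → ℝ)
    (h : (ς, extChartAt (𝓡 m) x x) ∈ chartDomain n m x) :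
    HasDerivAt (fun s : ℝ => chartAction n m x (ς + s • ζ, extChartAt (𝓡 m) x x))
      (fderiv ℝ (chartAction n m x) (ς, extChartAt (𝓡 m) x x) (ζ, 0)) 0 := by
  have h2 : HasDerivAt (fun s : ℝ => (ς + s • ζ, extChartAt (𝓡 m) x x)) (ζ, 0) 0 := by
    simpa using (((hasDerivAt_id (0 : ℝ)).smul_const ζ).const_add ς).prodMk
      (hasDerivAt_const (0 : ℝ) (extChartAt (𝓡 m) x x))
  refine HasFDerivAt.comp_hasDerivAt (0 : ℝ) (l := chartAction n m x) ?_ h2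
  rw [zero_smul, add_zero]
  exact hasFDerivAt_chartAction hsm h

theorem hasDerivAt_chartAction_zero (x : M) (ζ : Fin n → ℝ) :
    HasDerivAt (fun s : ℝ => chartAction n m x (s • ζ, extChartAt (𝓡 m) x x))
      (infAction n m x ζ) 0 := by
  have h := hasDerivAt_chartAction_add hsm ζ
    (mem_chartDomain_zero (n := n) (mem_extChartAt_source (I := 𝓡 m) x))
  simp only [zero_add] at h
  exact h

/-- The orbit map intertwines translations and the action. -/
theorem fderiv_chartAction_inl_eq {x : M} {ς : Fin n → ℝ} (ζ : Fin n → ℝ)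
    (h : (ς, extChartAt (𝓡 m) x x) ∈ chartDomain n m x) :
    fderiv ℝ (chartAction n m x) (ς, extChartAt (𝓡 m) x x) (ζ, 0)
      = spaceDeriv n m x (ς, extChartAt (𝓡 m) x x) (infAction n m x ζ) := by
  have h1 := hasDerivAt_chartAction_add hsm ζ h
  have h0 : torusExp ((0 : ℝ) • ζ) • x = x := by rw [zero_smul, torusExp_zero, one_smul]
  have h2 : HasDerivAt (fun s : ℝ => chartAction n m x
      (ς, chartAction n m x (s • ζ, extChartAt (𝓡 m) x x)))
      (spaceDeriv n m x (ς, extChartAt (𝓡 m) x x) (infAction n m x ζ)) 0 := by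
    refine HasFDerivAt.comp_hasDerivAt (0 : ℝ) (l := fun y => chartAction n m x (ς, y)) ?_
      (hasDerivAt_chartAction_zero hsm x ζ)
    rw [chartAction_self h0]
    exact hasFDerivAt_spaceDeriv hsm h
  refine h1.unique (h2.congr_of_eventuallyEq ?_)
  have hc : Continuous fun s : ℝ => (s • ζ, extChartAt (𝓡 m) x x) := by fun_prop
  have h5 : ∀ᶠ s : ℝ in 𝓝 0, (s • ζ, extChartAt (𝓡 m) x x) ∈ chartDomain n m x :=
    hc.continuousAt.eventually_mem ((isOpen_chartDomain hsm x).mem_nhds (mem_chartDomain_self h0))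
  filter_upwards [h5] with s hs
  simp only [chartAction, (extChartAt (𝓡 m) x).left_inv hs.2, torusExp_add, mul_smul]

/-- One-parameter subgroups generated by a vector field vanishing at `x` fix `x`. -/
theorem torusExp_smul_eq_of_infAction {x : M} {ς : Fin n → ℝ} (hς : infAction n m x ς = 0) (s : ℝ) :
    torusExp (s • ς) • x = x := by
  have hc : Continuous fun s : ℝ => (s • ς, extChartAt (𝓡 m) x x) := by fun_prop
  have h0 : torusExp ((0 : ℝ) • ς) • x = x := by rw [zero_smul, torusExp_zero, one_smul]
  have h1 : ∀ᶠ s : ℝ in 𝓝 0, (s • ς, extChartAt (𝓡 m) x x) ∈ chartDomain n m x :=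
    hc.continuousAt.eventually_mem ((isOpen_chartDomain hsm x).mem_nhds (mem_chartDomain_self h0))
  obtain ⟨δ, hδ, hball⟩ := Metric.eventually_nhds_iff_ball.mp h1
  -- By the group law the velocity at time `s` is the image of the velocity at time `0`, which
  -- vanishes.
  have hder : ∀ s ∈ Metric.ball (0 : ℝ) δ, HasDerivWithinAt
      (fun s : ℝ => chartAction n m x (s • ς, extChartAt (𝓡 m) x x)) 0
      (Metric.ball (0 : ℝ) δ) s := by
    intro s hs
    have h2 := hasDerivAt_chartAction_add hsm ς (hball s hs)
    rw [fderiv_chartAction_inl_eq hsm ς (hball s hs), hς, map_zero] at h2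
    have h3 : HasDerivAt (fun r : ℝ => r - s) 1 s := (hasDerivAt_id s).sub_const s
    have h4 := HasDerivAt.scomp_of_eq s h2 h3 (sub_self s).symm
    simp only [smul_zero] at h4
    refine HasDerivAt.hasDerivWithinAt ?_
    convert! h4 using 1
    funext r
    simp only [Function.comp_apply]
    congr 2
    module
  have hnear : ∀ s ∈ Metric.ball (0 : ℝ) δ, torusExp (s • ς) • x = x := by
    intro s hs
    have h2 := (convex_ball (0 : ℝ) δ).is_const_of_fderivWithin_eq_zero (𝕜 := ℝ)
      (f := fun s : ℝ => chartAction n m x (s • ς, extChartAt (𝓡 m) x x))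
      (fun r hr => (hder r hr).differentiableWithinAt)
      (fun r hr => by
        have := (hder r hr).hasFDerivWithinAt.fderivWithin
          (Metric.isOpen_ball.uniqueDiffWithinAt hr)
        rw [this]; ext; simp) hs (Metric.mem_ball_self hδ)
    rw [chartAction_self h0, chartAction_apply (mem_extChartAt_source x)] at h2
    have h3 := (hball s hs).2
    rw [extChartAt_to_inv] at h3
    exact (extChartAt (𝓡 m) x).injOn h3 (mem_extChartAt_source x) h2
  have hmul : ∀ (k : ℕ) (s : ℝ), torusExp (s • ς) • x = x → torusExp ((k * s) • ς) • x = x := by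
    intro k s hs
    induction k with
    | zero => simp [torusExp_zero]
    | succ k ih =>
      have e : (((k + 1 : ℕ) : ℝ) * s) • ς = (k * s) • ς + s • ς := by push_cast; module
      rw [e, torusExp_add, mul_smul, hs, ih]
  -- An arbitrary time is a multiple of one inside the ball.
  obtain ⟨k, hk⟩ := exists_nat_gt (|s| / δ)
  have hkpos : (0 : ℝ) < k := lt_of_le_of_lt (by positivity) hk
  have h2 := hmul k (s / k) (hnear _ (by
    rw [mem_ball_zero_iff, Real.norm_eq_abs, abs_div, Nat.abs_cast, div_lt_iff₀ hkpos, mul_comm]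
    exact (div_lt_iff₀ hδ).mp hk))
  rwa [mul_div_cancel₀ _ hkpos.ne'] at h2

/-- The torus is commutative, so a stabilizing element fixes every point of the orbit and hence
every vector tangent to it. -/
theorem spaceDeriv_infAction {x : M} {ς : Fin n → ℝ} (hς : torusExp ς • x = x) (ζ : Fin n → ℝ) :
    spaceDeriv n m x (ς, extChartAt (𝓡 m) x x) (infAction n m x ζ) = infAction n m x ζ := by
  rw [← fderiv_chartAction_inl_eq hsm ζ (mem_chartDomain_self hς)]
  refine (hasDerivAt_chartAction_add hsm ζ (mem_chartDomain_self hς)).unique ?_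
  have h := hasDerivAt_chartAction_zero hsm x ζ
  have e : (fun s : ℝ => chartAction n m x (ς + s • ζ, extChartAt (𝓡 m) x x))
      = fun s : ℝ => chartAction n m x (s • ζ, extChartAt (𝓡 m) x x) := by
    funext s
    rw [chartAction_apply (mem_extChartAt_source x), chartAction_apply (mem_extChartAt_source x),
      add_comm, torusExp_add, mul_smul, hς]
  rwa [e]

theorem linAction_infAction {x : M} {ς : Fin n → ℝ} (hς : infAction n m x ς = 0) (ζ : Fin n → ℝ) :
    linAction n m x ς (infAction n m x ζ) = 0 := by
  have h1 : HasDerivAt (fun s : ℝ => spaceDeriv n m x (s • ς, extChartAt (𝓡 m) x x)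
      (infAction n m x ζ)) (linAction n m x ς (infAction n m x ζ)) 0 := by
    simpa using (hasDerivAt_spaceDeriv hsm x ς).clm_apply
      (hasDerivAt_const (0 : ℝ) (infAction n m x ζ))
  simp only [spaceDeriv_infAction hsm (torusExp_smul_eq_of_infAction hsm hς _)] at h1
  exact h1.unique (hasDerivAt_const _ _)

theorem linAction_comm {x : M} {ς ζ : Fin n → ℝ} (hς : infAction n m x ς = 0)
    (hζ : infAction n m x ζ = 0) (v : EuclideanSpace ℝ (Fin m)) :
    linAction n m x ς (linAction n m x ζ v) = linAction n m x ζ (linAction n m x ς v) := by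
  have hcomm : ∀ (s t : ℝ) v, spaceDeriv n m x (s • ς, extChartAt (𝓡 m) x x)
      (spaceDeriv n m x (t • ζ, extChartAt (𝓡 m) x x) v)
      = spaceDeriv n m x (t • ζ, extChartAt (𝓡 m) x x)
        (spaceDeriv n m x (s • ς, extChartAt (𝓡 m) x x) v) := by
    intro s t v
    have hs := torusExp_smul_eq_of_infAction hsm hς s
    have ht := torusExp_smul_eq_of_infAction hsm hζ t
    rw [← ContinuousLinearMap.comp_apply, ← spaceDeriv_add hsm hs ht, add_comm,
      spaceDeriv_add hsm ht hs, ContinuousLinearMap.comp_apply]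
  refine (HasDerivAt.apply_comm_of_comm (hasDerivAt_spaceDeriv hsm x ζ) (fun t w => ?_) v).symm
  exact ((hasDerivAt_spaceDeriv hsm x ς).apply_comm_of_comm (fun s w => hcomm s t w) w).symm

/-- A one-parameter group of isotropy maps with zero generator is constant. Faithfulness then makes
the subgroup `torusExp (s • ς)` trivial. -/
theorem eq_zero_of_linAction [T2Space M] [PreconnectedSpace M]
    (heff : ∀ t : Torus n, (∀ x : M, t • x = x) → t = 1) {x : M} {ς : Fin n → ℝ}
    (hς : infAction n m x ς = 0) (hN : linAction n m x ς = 0) : ς = 0 := by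
  have hfix := torusExp_smul_eq_of_infAction hsm hς
  have hder : ∀ s : ℝ, HasDerivAt
      (fun s : ℝ => spaceDeriv n m x (s • ς, extChartAt (𝓡 m) x x)) 0 s := by
    intro s
    have h1 := hasDerivAt_spaceDeriv hsm x ς
    rw [hN] at h1
    have h2 : HasDerivAt (fun r : ℝ => r - s) 1 s := (hasDerivAt_id s).sub_const s
    have h3 := HasDerivAt.scomp_of_eq s h1 h2 (sub_self s).symm
    have h4 := (hasDerivAt_const s (spaceDeriv n m x (s • ς, extChartAt (𝓡 m) x x))).clm_comp h3
    convert! h4 using 1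
    · funext r
      simp only [Function.comp_apply]
      rw [← spaceDeriv_add hsm (hfix _) (hfix _)]
      congr 2
      module
    · simp
  refine eq_zero_of_torusExp_smul fun s => torusExp_eq_one_of_spaceDeriv hsm heff (hfix s) ?_
  have h1 := is_const_of_deriv_eq_zero (fun s => (hder s).differentiableAt)
    (fun s => (hder s).deriv) s 0
  rw [h1, zero_smul, spaceDeriv_zero hsm]

/-- Near a point at which the linearized action has a generic vector, there are points at which the
infinitesimal action is injective. -/
theorem frequently_infAction_injective {x : M} {v : EuclideanSpace ℝ (Fin m)}
    (hv : ∀ ς ζ, infAction n m x ς = 0 → linAction n m x ς v = infAction n m x ζ → ς = 0) :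
    ∃ᶠ y in 𝓝 x, ∀ ς : Fin n → ℝ, fundField m M ς y = 0 → ς = 0 := by
  set φ := extChartAt (𝓡 m) x with hφ
  -- `ψ ε` is the infinitesimal action, read in the chart, at the point displaced from `x` by `ε •
  -- v`.
  let ψ : ℝ → (Fin n → ℝ) →L[ℝ] EuclideanSpace ℝ (Fin m) := fun ε =>
    (fderiv ℝ (chartAction n m x) (0, φ x + ε • v)).comp (ContinuousLinearMap.inl ℝ _ _)
  let ψ' : (Fin n → ℝ) →L[ℝ] EuclideanSpace ℝ (Fin m) :=
    (fderiv ℝ (fderiv ℝ (chartAction n m x)) (0, φ x) (0, v)).comp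
      (ContinuousLinearMap.inl ℝ _ _)
  have hψ : HasDerivAt ψ ψ' 0 := by
    have h1 : HasFDerivAt (fderiv ℝ (chartAction n m x))
        (fderiv ℝ (fderiv ℝ (chartAction n m x)) (0, φ x))
        ((0 : Fin n → ℝ), φ x + (0 : ℝ) • v) := by
      rw [zero_smul, add_zero]
      exact ((contDiffAt_fderiv_chartAction hsm
        (mem_chartDomain_zero (mem_extChartAt_source x))).differentiableAt (by simp)).hasFDerivAt
    have h2 : HasDerivAt (fun s : ℝ => ((0 : Fin n → ℝ), φ x + s • v)) (0, v) 0 := by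
      simpa using (hasDerivAt_const (0 : ℝ) (0 : Fin n → ℝ)).prodMk
        (((hasDerivAt_id (0 : ℝ)).smul_const v).const_add (φ x))
    have h3 := h1.comp_hasDerivAt (0 : ℝ) h2
    exact (ContinuousLinearMap.precomp (EuclideanSpace ℝ (Fin m))
      (ContinuousLinearMap.inl ℝ (Fin n → ℝ) (EuclideanSpace ℝ (Fin m)))).hasFDerivAt.comp_hasDerivAt (0 : ℝ) h3
  have hψ0 : ∀ ς, ψ 0 ς = infAction n m x ς := by
    intro ς
    simp only [ψ, zero_smul, add_zero]
    rfl
  have hinj := eventually_injective_of_hasDerivAt hψ fun ς ζ h1 h2 =>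
    hv ς ζ (by rw [← hψ0, h1]) (by rw [linAction_apply_swap hsm, ← hψ0, ← h2]; rfl)
  have hc : ContinuousAt (fun ε : ℝ => φ x + ε • v) 0 := by fun_prop
  have htgt : ∀ᶠ ε in 𝓝[≠] (0 : ℝ), φ x + ε • v ∈ φ.target := by
    refine nhdsWithin_le_nhds (hc.eventually_mem ?_)
    rw [zero_smul, add_zero]
    exact extChartAt_target_mem_nhds (I := 𝓡 m) x
  have htend : Tendsto (fun ε : ℝ => φ.symm (φ x + ε • v)) (𝓝[≠] 0) (𝓝 x) := by
    have h1 : ContinuousAt φ.symm (φ x + (0 : ℝ) • v) := by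
      rw [zero_smul, add_zero]
      exact continuousAt_extChartAt_symm (I := 𝓡 m) x
    have h2 : ContinuousAt (fun ε : ℝ => φ.symm (φ x + ε • v)) 0 :=
      ContinuousAt.comp (g := φ.symm) h1 hc
    have h3 := h2.tendsto.mono_left (nhdsWithin_le_nhds (s := {0}ᶜ))
    simpa [hφ] using h3
  refine htend.frequently (Eventually.frequently ?_)
  filter_upwards [hinj, htgt] with ε h1 h2 ς hς
  refine (injective_iff_map_eq_zero (ψ ε)).mp h1 ς ?_
  have h3 := fderiv_chartAction_inl hsm (φ.map_target h2) ς
  rw [hς, φ.right_inv h2] at h3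
  exact h3.trans (map_zero _)

end Linearization

/-! ### Generalized complex structures of symplectic type -/

section SymplecticType

variable {V : Type*} [AddCommGroup V] [Module ℝ V] [TopologicalSpace V]
  [IsTopologicalAddGroup V] [ContinuousSMul ℝ V] [T2Space V] [FiniteDimensional ℝ V]

theorem flatEquiv_apply (σ : V [⋀^Fin 2]→L[ℝ] ℝ) (hσ : ∀ X : V, (∀ Y, σ ![X, Y] = 0) → X = 0)
    (X : V) : flatEquiv σ hσ X = contract₂ σ X := rfl

theorem bTransform_neg_symplecticEndo_inr (σ b : V [⋀^Fin 2]→L[ℝ] ℝ)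
    (hσ : ∀ X : V, (∀ Y, σ ![X, Y] = 0) → X = 0) (ξ : V →L[ℝ] ℝ) :
    (bTransform (-b) ∘ₗ symplecticEndo σ hσ ∘ₗ bTransform b) (0, ξ)
      = ((flatEquiv σ hσ).symm ξ, -contract₂ b ((flatEquiv σ hσ).symm ξ)) := by
  refine Prod.ext ?_ (ContinuousLinearMap.ext fun v => ?_)
  · simp [bTransform, symplecticEndo]
  · simp [bTransform, symplecticEndo, contract₂_apply]

theorem bTransform_neg_symplecticEndo_graph (σ b : V [⋀^Fin 2]→L[ℝ] ℝ)
    (hσ : ∀ X : V, (∀ Y, σ ![X, Y] = 0) → X = 0) (X : V) :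
    (bTransform (-b) ∘ₗ symplecticEndo σ hσ ∘ₗ bTransform b) (X, -contract₂ b X)
      = (0, -contract₂ σ X) := by
  refine Prod.ext ?_ (ContinuousLinearMap.ext fun v => ?_)
  · simp [bTransform, symplecticEndo]
  · simp [bTransform, symplecticEndo, flatEquiv_apply]

end SymplecticType

/-! ### Invariant structures at a fixed point -/

section Invariance

variable {n m : ℕ} {M : Type*} [TopologicalSpace M]
  [ChartedSpace (EuclideanSpace ℝ (Fin m)) M] [IsManifold (𝓡 m) ∞ M] [MulAction (Torus n) M]

theorem isPushforward_of_isTorusInvariant (hsm : IsSmoothAction n m M) {J : GenEndo m M}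
    (hJ : IsTorusInvariant n J) {x : M} {ς : Fin n → ℝ} (hς : torusExp ς • x = x)
    (E : TangentSpace (𝓡 m) x →L[ℝ] TangentSpace (𝓡 m) x)
    (hE : E = spaceDeriv n m x (ς, extChartAt (𝓡 m) x x)) (u u' : GenTangent m x)
    (h : IsGenMetric.IsPushforward E u u') : IsGenMetric.IsPushforward E (J x u) (J x u') := by
  have hA : ∀ v, actionDeriv m (torusExp ς) x v = E v := fun v => by
    rw [hE]; exact actionDeriv_eq hsm hς v
  -- The target fibre lies over `torusExp ς • x`; a free `x'` allows its identification with the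
  -- fibre over `x`.
  have key : ∀ x' (_ : torusExp ς • x = x') (A : TangentSpace (𝓡 m) x →L[ℝ] TangentSpace (𝓡 m) x')
      (_ : ∀ v, actionDeriv m (torusExp ς) x v = A v) (u' : GenTangent m x'),
      u'.1 = A u.1 ∧ u.2 = u'.2.comp A →
      (J x' u').1 = A (J x u).1 ∧ (J x u).2 = (J x' u').2.comp A := by
    rintro x' rfl A hA u' hu'
    have e : actionDeriv m (torusExp ς) x = A := ContinuousLinearMap.ext hA
    subst e
    exact hJ _ x u u' hu'
  exact key x hς E hA u' h

/-- The derivative of a smooth function along a smooth vector field is smooth. -/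
theorem IsSmoothVField.contMDiff_mvfderiv {f : M → ℝ} (hf : ContMDiff (𝓡 m) 𝓘(ℝ, ℝ) ∞ f)
    {Y : VField m M} (hY : IsSmoothVField Y) :
    ContMDiff (𝓡 m) 𝓘(ℝ, ℝ) ∞ fun x => mvfderiv (𝓡 m) f x (Y x) := by
  have h1 : ContMDiff (𝓡 m).tangent 𝓘(ℝ, ℝ).tangent ∞ (tangentMap (𝓡 m) 𝓘(ℝ, ℝ) f) :=
    hf.contMDiff_tangentMap (by simp)
  exact (contMDiff_snd_tangentBundle_modelSpace ℝ 𝓘(ℝ, ℝ)).comp (h1.comp hY)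

theorem continuous_poisson {H : DForm m M 3} (K : GenKahler H) {f h : M → ℝ}
    (hf : ContMDiff (𝓡 m) 𝓘(ℝ, ℝ) ∞ f) (hh : ContMDiff (𝓡 m) 𝓘(ℝ, ℝ) ∞ h) :
    Continuous fun x => mvfderiv (𝓡 m) h x (K.β₁ x (mvfderiv (𝓡 m) f x)) := by
  have h1 : IsSmoothGenField fun x : M => ((0, mvfderiv (𝓡 m) f x) : GenTangent m x) :=
    ⟨Bundle.contMDiff_zeroSection ℝ (TangentSpace (𝓡 m) : M → Type _), fun Y hY =>
      hY.contMDiff_mvfderiv hf⟩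
  exact ((K.genComplex₁.smooth _ h1).1.contMDiff_mvfderiv hh).continuous

end Invariance

/-! ### Toric symplectic manifolds -/

namespace IsToricSymplectic

variable {n : ℕ} {M : Type*} [TopologicalSpace M]
  [ChartedSpace (EuclideanSpace ℝ (Fin (2 * n))) M] [IsManifold (𝓡 (2 * n)) ∞ M]
  [MulAction (Torus n) M] {Ω : SymplecticForm (2 * n) M} {μ : M → StrongDual ℝ (Fin n → ℝ)}
  (hM : IsToricSymplectic Ω μ)
include hM

theorem isSmoothAction : IsSmoothAction n (2 * n) M := hM.smooth_action

theorem contMDiff_apply (ς : Fin n → ℝ) :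
    ContMDiff (𝓡 (2 * n)) 𝓘(ℝ, ℝ) ∞ fun x => μ x ς :=
  (ContinuousLinearMap.apply ℝ ℝ ς).contMDiff.comp hM.smooth_moment

/-- `μ` is constant along orbits; by the moment equation this makes the orbits isotropic. -/
theorem mvfderiv_fundField (ς ζ : Fin n → ℝ) (x : M) :
    mvfderiv (𝓡 (2 * n)) (fun y => μ y ς) x (fundField (2 * n) M ζ x) = 0 := by
  have h0 : torusExp ((0 : ℝ) • ζ) • x = x := by rw [zero_smul, torusExp_zero, one_smul]
  have h1 : HasMFDerivAt 𝓘(ℝ, ℝ) (𝓡 (2 * n)) (fun s : ℝ => torusExp (s • ζ) • x) 0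
      (mfderiv 𝓘(ℝ, ℝ) (𝓡 (2 * n)) (fun s : ℝ => torusExp (s • ζ) • x) 0) :=
    ((contMDiff_orbit hM.isSmoothAction ζ x).mdifferentiable (by simp) 0).hasMFDerivAt
  have h2 := ((hM.contMDiff_apply ς).mdifferentiable (by simp)
    (torusExp ((0 : ℝ) • ζ) • x)).hasMFDerivAt
  have h3 := (h2.comp (0 : ℝ) h1).hasFDerivAt
  have h4 : ((fun y => μ y ς) ∘ fun s : ℝ => torusExp (s • ζ) • x) = fun _ => μ x ς := by
    funext s
    simp only [Function.comp_apply, hM.invariant]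
  rw [h4] at h3
  have h6 : HasFDerivAt (fun _ : ℝ => μ x ς) (0 : ℝ →L[ℝ] ℝ) 0 := hasFDerivAt_const _ _
  have h5 := congrArg (fun L : ℝ →L[ℝ] ℝ => L 1) (h6.unique h3)
  have key : ∀ z, z = x → ∀ v : EuclideanSpace ℝ (Fin (2 * n)),
      (mfderiv (𝓡 (2 * n)) 𝓘(ℝ, ℝ) (fun y => μ y ς) z : EuclideanSpace ℝ (Fin (2 * n)) →L[ℝ] ℝ) v
        = (mfderiv (𝓡 (2 * n)) 𝓘(ℝ, ℝ) (fun y => μ y ς) x :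
          EuclideanSpace ℝ (Fin (2 * n)) →L[ℝ] ℝ) v := by
    rintro z rfl v
    rfl
  exact (key _ h0 _).symm.trans h5.symm

theorem moment_apply (ς : Fin n → ℝ) (x : M) (v : TangentSpace (𝓡 (2 * n)) x) :
    mvfderiv (𝓡 (2 * n)) (fun y => μ y ς) x v = -Ω.form x ![fundField (2 * n) M ς x, v] := by
  rw [← contract₂_apply, hM.moment, neg_apply, neg_neg]

/-- The moment map is open at the points with discrete stabilizer. -/
theorem mem_momentInterior {x : M} (hx : ∀ ς : Fin n → ℝ, fundField (2 * n) M ς x = 0 → ς = 0) :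
    x ∈ momentInterior μ := by
  set φ := extChartAt (𝓡 (2 * n)) x with hφ
  have hF : ContDiffAt ℝ ∞ (μ ∘ φ.symm) (φ x) := by
    rw [← contMDiffAt_iff_contDiffAt]
    refine ContMDiffAt.comp (φ x) hM.smooth_moment.contMDiffAt ?_
    exact (contMDiffOn_extChartAt_symm x).contMDiffAt (extChartAt_target_mem_nhds x)
  have hval : ∀ v : EuclideanSpace ℝ (Fin (2 * n)), ∀ ς : Fin n → ℝ,
      fderiv ℝ (μ ∘ φ.symm) (φ x) v ς = mvfderiv (𝓡 (2 * n)) (fun y => μ y ς) x v := by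
    intro v ς
    have h1 : HasFDerivAt (fun y => μ (φ.symm y) ς)
        ((ContinuousLinearMap.apply ℝ ℝ ς).comp (fderiv ℝ (μ ∘ φ.symm) (φ x))) (φ x) :=
      (ContinuousLinearMap.apply ℝ ℝ ς).hasFDerivAt.comp (φ x)
        (hF.differentiableAt (by simp)).hasFDerivAt
    have h2 := ((hM.contMDiff_apply ς).mdifferentiable (by simp) x).mvfderiv
    have h3 : mvfderiv (𝓡 (2 * n)) (fun y => μ y ς) x
        = fderiv ℝ (fun y => μ (φ.symm y) ς) (φ x) := by
      have h4 : writtenInExtChartAt (𝓡 (2 * n)) 𝓘(ℝ, ℝ) x (fun y => μ y ς)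
          = fun y => μ (φ.symm y) ς := rfl
      refine h2.trans ?_
      rw [h4, modelWithCornersSelf_coe, Set.range_id, fderivWithin_univ]
    rw [h3, h1.fderiv]
    rfl
  have hinj : LinearMap.ker (infAction n (2 * n) x) = ⊥ :=
    LinearMap.ker_eq_bot'.mpr fun ς h => hx ς (by rw [← infAction_apply hM.isSmoothAction]; exact h)
  obtain ⟨B, hB⟩ := LinearMap.exists_leftInverse_of_injective _ hinj
  -- Given `ℓ`, a left inverse `B` of the infinitesimal action extends it to a covector `ℓ ∘ B`. The
  -- vector `v` with `ι_v Ω = ℓ ∘ B` satisfies `dμ(v) = ℓ`.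
  have hsurj : (fderiv ℝ (μ ∘ φ.symm) (φ x)).range = ⊤ := by
    refine LinearMap.range_eq_top.mpr fun ℓ => ?_
    let ξ : TangentSpace (𝓡 (2 * n)) x →L[ℝ] ℝ :=
      LinearMap.toContinuousLinearMap ((ℓ : (Fin n → ℝ) →ₗ[ℝ] ℝ) ∘ₗ B)
    obtain ⟨v, hv⟩ := (flatEquiv (Ω.form x) (Ω.nondegenerate x)).surjective ξ
    refine ⟨v, ContinuousLinearMap.ext fun ς => ?_⟩
    have h1 : Ω.form x ![v, fundField (2 * n) M ς x] = ℓ ς := by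
      rw [← contract₂_apply, ← flatEquiv_apply (hσ := Ω.nondegenerate x), hv]
      have h2 : B (infAction n (2 * n) x ς) = ς := LinearMap.congr_fun hB ς
      rw [infAction_apply hM.isSmoothAction] at h2
      exact congrArg ℓ h2
    have h2 : Ω.form x ![fundField (2 * n) M ς x, v] = -Ω.form x ![v, fundField (2 * n) M ς x] := by
      have := (Ω.form x).toAlternatingMap.map_swap ![v, fundField (2 * n) M ς x]
        (i := 0) (j := 1) (by decide)
      rw [← ContinuousAlternatingMap.coe_toAlternatingMap, ← this]
      congr 1
      funext i
      fin_cases i <;> simp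
    refine (hval v ς).trans ?_
    rw [hM.moment_apply, h2, neg_neg, h1]
  have hstrict : HasStrictFDerivAt (μ ∘ φ.symm) (fderiv ℝ (μ ∘ φ.symm) (φ x)) (φ x) :=
    hF.hasStrictFDerivAt (by simp)
  have hmap := hstrict.map_nhds_eq_of_surj hsurj
  have hx0 : (μ ∘ φ.symm) (φ x) = μ x := by simp [hφ]
  rw [hx0] at hmap
  refine mem_interior_iff_mem_nhds.mpr ?_
  rw [← hmap]
  refine mem_map.mpr (univ_mem' fun y => ⟨φ.symm y, rfl⟩)

variable {H : DForm (2 * n) M 3} {K : GenKahler H} {b : DForm (2 * n) M 2}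

/-- The transform `e^b` takes the extended action to `X_ς`, which `J_Ω` sends to `-ι_{X_ς} Ω =
dμ_ς`. Only the Poisson condition of a strong Hamiltonian action carries content. -/
theorem isHamiltonian (hK : K.IsSymplecticType Ω b) : IsHamiltonian K (extendedAction b) μ where
  equivariant := hM.invariant
  moment_re ς x := by
    rw [hK x]
    refine (bTransform_neg_symplecticEndo_graph (Ω.form x) (b x) (Ω.nondegenerate x) _).trans ?_
    rw [hM.moment, neg_neg]
  moment_im ς x := by
    have h1 : mvfderiv (𝓡 (2 * n)) (fun y => μ y ς) x
        = flatEquiv (Ω.form x) (Ω.nondegenerate x) (-fundField (2 * n) M ς x) := by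
      rw [map_neg, flatEquiv_apply, hM.moment, neg_neg]
    rw [hK x]
    refine (congrArg Neg.neg (bTransform_neg_symplecticEndo_inr (Ω.form x) (b x)
      (Ω.nondegenerate x) _)).trans ?_
    rw [h1, LinearEquiv.symm_apply_apply]
    simp [extendedAction]

variable [T2Space M] [PreconnectedSpace M]

/-- Every point is a limit of points over the interior of the moment polytope, and at every point
anti-diagonality is equivalent to the vanishing of the Poisson brackets. -/
theorem frequently_momentInterior_and_antiDiagonal_iff (hK : K.IsSymplecticType Ω b)
    (hinv₁ : IsTorusInvariant n K.J₁) (hinv₂ : IsTorusInvariant n K.J₂) (x : M) :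
    ((∃ᶠ y in 𝓝 x, y ∈ momentInterior μ) ∧
    ((orbitTangent n (2 * n) x).map (K.Jplus x) = (orbitTangent n (2 * n) x).map (K.Jminus x) ↔
      ∀ ς ζ : Fin n → ℝ, mvfderiv (𝓡 (2 * n)) (fun y => μ y ζ) x
        (K.β₁ x (mvfderiv (𝓡 (2 * n)) (fun y => μ y ς) x)) = 0)) := by
  have hsm := hM.isSmoothAction
  have hG := K.metric x
  have hcomm : ∀ u, K.J₁ x (K.J₂ x u) = K.J₂ x (K.J₁ x u) := LinearMap.congr_fun (K.comm x)
  have hsq := K.genComplex₁.sq x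
  have horth := K.genComplex₁.orthogonal x
  let X : (Fin n → ℝ) →ₗ[ℝ] TangentSpace (𝓡 (2 * n)) x := infAction n (2 * n) x
  have hXf : ∀ ς, X ς = fundField (2 * n) M ς x := infAction_apply hsm x
  let α : (Fin n → ℝ) →ₗ[ℝ] (TangentSpace (𝓡 (2 * n)) x →L[ℝ] ℝ) := -(contract₂ (Ω.form x) ∘ₗ X)
  have hα : ∀ ς, α ς = mvfderiv (𝓡 (2 * n)) (fun y => μ y ς) x := by
    intro ς
    have h1 : α ς = -contract₂ (Ω.form x) (X ς) := rfl
    rw [h1, hXf, hM.moment, neg_neg]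
  have hJ₂ : ∀ ξ, (K.J₂ x (0, ξ)).1 = (flatEquiv (Ω.form x) (Ω.nondegenerate x)).symm ξ := by
    intro ξ
    rw [hK x]
    exact congrArg Prod.fst
      (bTransform_neg_symplecticEndo_inr (Ω.form x) (b x) (Ω.nondegenerate x) ξ)
  have hX : ∀ ς, X ς = -(K.J₂ x (0, α ς)).1 := by
    intro ς
    have h1 : α ς = flatEquiv (Ω.form x) (Ω.nondegenerate x) (-X ς) := by
      rw [map_neg]; rfl
    rw [hJ₂, h1, LinearEquiv.symm_apply_apply, neg_neg]
  have hnd : ∀ ξ, (K.J₂ x (0, ξ)).1 = 0 → ξ = 0 := by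
    intro ξ h
    rw [hJ₂] at h
    exact (LinearEquiv.map_eq_zero_iff _).mp h
  have hiso : ∀ ς ζ, α ς (X ζ) = 0 := by
    intro ς ζ
    rw [hα, hXf]
    exact hM.mvfderiv_fundField ς ζ x
  let N : LinearMap.ker X →ₗ[ℝ] TangentSpace (𝓡 (2 * n)) x →ₗ[ℝ] TangentSpace (𝓡 (2 * n)) x :=
    (ContinuousLinearMap.coeLM ℝ) ∘ₗ (linAction n (2 * n) x).toLinearMap ∘ₗ
      (LinearMap.ker X).subtype
  have hN : ∀ a v, N a v = linAction n (2 * n) x a v := fun _ _ => rfl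
  have hker : ∀ a : LinearMap.ker X, infAction n (2 * n) x a = 0 := fun a => a.2
  have hNcomm : ∀ a c v, N a (N c v) = N c (N a v) := fun a c v =>
    linAction_comm hsm (hker a) (hker c) v
  have hNX : ∀ a ς, N a (X ς) = 0 := fun a ς => linAction_infAction hsm (hker a) ς
  have hNinj : ∀ a, N a = 0 → a = 0 := by
    intro a ha
    exact Subtype.ext (eq_zero_of_linAction hsm hM.effective (hker a)
      (ContinuousLinearMap.ext fun v => LinearMap.congr_fun ha v))
  have hinvE : ∀ (a : LinearMap.ker X) (s : ℝ) v,
      spaceDeriv n (2 * n) x (s • (a : Fin n → ℝ), extChartAt (𝓡 (2 * n)) x x)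
        (spaceDeriv n (2 * n) x (-s • (a : Fin n → ℝ), extChartAt (𝓡 (2 * n)) x x) v) = v := by
    intro a s v
    rw [← ContinuousLinearMap.comp_apply, ← spaceDeriv_add hsm
      (torusExp_smul_eq_of_infAction hsm (hker a) s)
      (torusExp_smul_eq_of_infAction hsm (hker a) (-s)), ← add_smul, add_neg_cancel, zero_smul,
      spaceDeriv_zero hsm]
    rfl
  have hE₁ : ∀ (a : LinearMap.ker X) (s : ℝ), _ := fun a s =>
    isPushforward_of_isTorusInvariant hsm hinv₁ (torusExp_smul_eq_of_infAction hsm (hker a) s)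
      (spaceDeriv n (2 * n) x (s • (a : Fin n → ℝ), extChartAt (𝓡 (2 * n)) x x)) rfl
  have hE₂ : ∀ (a : LinearMap.ker X) (s : ℝ), _ := fun a s =>
    isPushforward_of_isTorusInvariant hsm hinv₂ (torusExp_smul_eq_of_infAction hsm (hker a) s)
      (spaceDeriv n (2 * n) x (s • (a : Fin n → ℝ), extChartAt (𝓡 (2 * n)) x x)) rfl
  -- Invariance at the fixed point says that the isotropy maps commute with `J₊` and `J₋`;
  -- differentiate at the identity.
  have hstr : ∀ (ε : ℝ) (hε : ε * ε = 1) (a : LinearMap.ker X) v,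
      N a (hG.tangentStr ε hε v) = hG.tangentStr ε hε (N a v) := by
    intro ε hε a v
    let B : EuclideanSpace ℝ (Fin (2 * n)) →L[ℝ] EuclideanSpace ℝ (Fin (2 * n)) :=
      LinearMap.toContinuousLinearMap
        (hG.tangentStr ε hε : EuclideanSpace ℝ (Fin (2 * n)) →ₗ[ℝ] EuclideanSpace ℝ (Fin (2 * n)))
    refine HasDerivAt.apply_comm_of_comm (hasDerivAt_spaceDeriv hsm x a) (B := B) (fun s w => ?_) v
    exact (hG.tangentStr_map ε hε (hinvE a s) (fun v => by
      have := hinvE a (-s) v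
      rwa [neg_neg] at this) (hE₁ a s) (hE₂ a s) w).symm
  have hNskew : ∀ a u v, hG.tangentMetric (N a u) v = -hG.tangentMetric u (N a v) := by
    intro a u v
    refine HasDerivAt.skew_of_isometry (hasDerivAt_spaceDeriv hsm x a)
      (by rw [zero_smul, spaceDeriv_zero hsm]) (g := hG.tangentMetric) (fun s u v => ?_) u v
    exact hG.tangentMetric_map (hinvE a s) (fun v => by
      have := hinvE a (-s) v
      rwa [neg_neg] at this) (hE₁ a s) (hE₂ a s) u v
  have hdim : Module.finrank ℝ (TangentSpace (𝓡 (2 * n)) x)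
      = 2 * Module.finrank ℝ (Fin n → ℝ) := by
    have : Module.finrank ℝ (TangentSpace (𝓡 (2 * n)) x)
      = Module.finrank ℝ (EuclideanSpace ℝ (Fin (2 * n))) := rfl
    rw [this]; simp
  constructor
  · obtain ⟨v, hv⟩ := exists_injective_orbit hG.tangentMetric_pos N hNcomm hNskew hNinj
    refine (frequently_infAction_injective hsm (v := v) fun ς ζ h1 h2 => ?_).mono
      fun y hy => hM.mem_momentInterior hy
    have h3 : N ⟨ς, h1⟩ v = X ζ := h2
    -- `N` kills orbit directions, so by skewness its image is orthogonal to them: `N v` in the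
    -- image of `X` has zero length.
    have h4 : N ⟨ς, h1⟩ v = 0 := by
      by_contra hne
      refine (hG.tangentMetric_pos _ hne).ne' ?_
      rw [hNskew, h3, hNX]
      simp
    exact congrArg Subtype.val (hv ⟨ς, h1⟩ h4)
  · have hspan : orbitTangent n (2 * n) x = LinearMap.range X := by
      have h1 : (Set.range fun ς : Fin n → ℝ => fundField (2 * n) M ς x) = LinearMap.range X := by
        ext v
        simp only [Set.mem_range, SetLike.mem_coe, LinearMap.mem_range, hXf]
      rw [orbitTangent, h1, Submodule.span_eq]
    have h2 := hG.map_range_eq_iff hcomm hsq horth X α hX hnd hiso N hNcomm hNskew hNinj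
      (hstr 1 (by norm_num)) (hstr (-1) (by norm_num)) hNX hdim
    rw [hspan]
    refine h2.trans ?_
    simp only [hα]
    rfl

end IsToricSymplectic

/-! ### Anti-diagonality and the strong Hamiltonian condition -/

theorem theorem4p3 {n : ℕ} {M : Type*} [TopologicalSpace M]
    [ChartedSpace (EuclideanSpace ℝ (Fin (2 * n))) M] [IsManifold (𝓡 (2 * n)) ∞ M]
    [T2Space M] [CompactSpace M] [ConnectedSpace M] [MulAction (Torus n) M]
    (Ω : SymplecticForm (2 * n) M) (μ : M → StrongDual ℝ (Fin n → ℝ))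
    (hM : IsToricSymplectic Ω μ)
    (H : DForm (2 * n) M 3) (hH : IsSmoothForm H) (hdH : H.d = 0)
    (K : GenKahler H)
    (b : DForm (2 * n) M 2) (hb : IsSmoothForm b) (hK : K.IsSymplecticType Ω b)
    (hinv₁ : IsTorusInvariant n K.J₁) (hinv₂ : IsTorusInvariant n K.J₂) :
    (IsAntiDiagonalOn n K (momentInterior μ) ↔ IsStrongHamiltonian K (extendedAction b) μ) ∧
    (IsAntiDiagonalOn n K Set.univ ↔ IsStrongHamiltonian K (extendedAction b) μ) := by
  have hpt := hM.frequently_momentInterior_and_antiDiagonal_iff hK hinv₁ hinv₂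
  have hto : IsStrongHamiltonian K (extendedAction b) μ → IsAntiDiagonalOn n K Set.univ :=
    fun h x _ => (hpt x).2.mpr fun ς ζ => h.poisson ς ζ x
  have hfrom : IsAntiDiagonalOn n K (momentInterior μ) →
      IsStrongHamiltonian K (extendedAction b) μ := by
    refine fun h => ⟨hM.isHamiltonian hK, fun ς ζ x => ?_⟩
    -- The zero set of the bracket is closed and contains the points over the interior of the
    -- polytope, which are dense.
    have hcl : IsClosed {y : M | mvfderiv (𝓡 (2 * n)) (fun y => μ y ζ) y
        (K.β₁ y (mvfderiv (𝓡 (2 * n)) (fun y => μ y ς) y)) = 0} :=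
      isClosed_eq (continuous_poisson K (hM.contMDiff_apply ς) (hM.contMDiff_apply ζ))
        continuous_const
    exact closure_minimal (fun y hy => (hpt y).2.mp (h y hy) ς ζ) hcl
      (mem_closure_iff_frequently.mpr (hpt x).1)
  exact ⟨⟨hfrom, fun h x _ => hto h x trivial⟩, ⟨fun h => hfrom fun x _ => h x trivial, hto⟩⟩
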